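/- For a polynomial $p(x)=a_nx^n+\dots+a_0$ of degree $n$ with integer coefficients let $H(p)=\max_{0\le i\le n}|a_i|$. The degree and the height of an algebraic number $\alpha$ are the degree and the height $H(p)$ of its minimal polynomial $p\in\mathbb Z[x]$, i.e. of a nonzero polynomial of least degree with $p(\alpha)=0$ and with coefficients whose greatest common divisor is $1$. For $S\subseteq\mathbb R$ and $Q>1$ let $\Phi_n(Q,S)$ be the number of algebraic numbers in $S$ of degree $n$ and height at most $Q$. Put $\ell(2)=1$ and $\ell(n)=0$ for $n\ge 3$, and let $\zeta$ be the Riemann zeta function. **Theorem 1.** Let $n\ge 2$. There is a continuous, positive function $\phi_n:\mathbb R\to\mathbb R$, integrable over $\mathbb R$, such that the following hold. 1. For all intervals $I\subseteq\mathbb R$, bounded or unbounded, and all real $Q\ge 2$, $$\Phi_n(Q,I)=\frac{Q^{n+1}}{2\zeta(n+1)}\int_I\phi_n(x)\,dx+O\!\left(Q^n(\ln Q)^{\ell(n)}\right),$$ where the implicit constant depends only on $n$. 2. For infinitely many families of intervals $I=I(Q)$ the true order of the remainder term is $Q^n$ as $Q\to\infty$. Precisely, for every $x_0\in\mathbb Q$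 there are intervals $I(Q)=[x_0-r(Q),x_0+r(Q)]$ with $r(Q)>0$ and constants $c_1,c_2>0$ such that for all sufficiently large $Q$ $$c_1Q^n\le\left|\Phi_n(Q,I(Q))-\frac{Q^{n+1}}{2\zeta(n+1)}\int_{I(Q)}\phi_n(x)\,dx\right|\le c_2Q^n .$$ 3. $\phi_n(-x)=\phi_n(x)$ for all $x\in\mathbb R$, and $x^2\phi_n(x)=\phi_n(1/x)$ for all $x\ne 0$. 4. For all $t\in\mathbb R$, $$\phi_n(t)=\int_{\Delta_n(t)}\left|\sum_{k=1}^n k\,p_k\,t^{k-1}\right|dp_1\cdots dp_n,$$ where $\Delta_n(t)=\left\{(p_1,\dots,p_n)\in\mathbb R^n:\ \max_{1\le i\le n}|p_i|\le 1,\ |p_nt^n+\dots+p_1t|\le 1\right\}$. 5. For every $x\in\mathbb R$ the limit $$F_n(x)=\lim_{Q\to\infty}\frac{\Phi_n(Q,(-\infty,x])}{\Phi_n(Q,\mathbb R)}$$ exists, the distribution function $F_n$ is continuously differentiable, and $F_n'(x)=\phi_n(x)\big/\int_{\mathbb R}\phi_n(y)\,dy$ for all $x$. -/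

import Mathlib

open MeasureTheory Filter Topology

noncomputable section

namespace RealAlgebraic

/-- The naive height of an integral polynomial: the maximum of the absolute values of its
coefficients. -/
def height (p : Polynomial ℤ) : ℕ := p.support.sup fun i => (p.coeff i).natAbs

/-- `p` is a minimal polynomial of `α` over the integers: a nonzero integral polynomial that
vanishes at `α`, has the least possible degree, and whose coefficients have greatest common
divisor `1`. (It is unique up to sign, and degree and height do not depend on the sign.) -/
def IsMinimalPolynomial (p : Polynomial ℤ) (α : ℝ) : Prop :=
  p ≠ 0 ∧ Polynomial.aeval α p = 0 ∧
    (∀ q : Polynomial ℤ, q ≠ 0 → Polynomial.aeval α q = 0 → p.natDegree ≤ q.natDegree) ∧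
    p.IsPrimitive

/-- The real algebraic numbers of degree `n` and height at most `Q`. -/
def algebraicNumbers (n : ℕ) (Q : ℝ) : Set ℝ :=
  {α | ∃ p : Polynomial ℤ, IsMinimalPolynomial p α ∧ p.natDegree = n ∧ (height p : ℝ) ≤ Q}

/-- The set that is counted below is finite. -/
theorem finite_algebraicNumbers (n : ℕ) (Q : ℝ) : (algebraicNumbers n Q).Finite := by
  refine (Polynomial.bUnion_roots_finite (algebraMap ℤ ℝ) n
    (Set.finite_Icc (-(⌊Q⌋₊ : ℤ)) ⌊Q⌋₊)).subset ?_
  rintro α ⟨p, ⟨hp, hα, -, -⟩, hn, hQ⟩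
  simp only [Set.mem_iUnion]
  refine ⟨p, ⟨hn.le, fun i => ?_⟩, ?_⟩
  · have h : (p.coeff i).natAbs ≤ ⌊Q⌋₊ := by
      by_cases hi : i ∈ p.support
      · exact (Finset.le_sup (f := fun i => (p.coeff i).natAbs) hi).trans (Nat.le_floor hQ)
      · simp [Polynomial.notMem_support_iff.mp hi]
    rw [Set.mem_Icc]
    omega
  · have h0 : p.map (algebraMap ℤ ℝ) ≠ 0 := by
      rwa [Polynomial.map_ne_zero_iff (algebraMap ℤ ℝ).injective_int]
    rw [SetLike.mem_coe, Multiset.mem_toFinset, Polynomial.mem_roots h0, Polynomial.IsRoot,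
      Polynomial.eval_map_algebraMap]
    exact hα

/-- The counting function: the number of real algebraic numbers of degree `n` and height at
most `Q` that lie in `S`. -/
def count (n : ℕ) (Q : ℝ) (S : Set ℝ) : ℕ := (algebraicNumbers n Q ∩ S).ncard

/-- The exponent of the logarithm (only used for `2 ≤ n`). -/
def ell (n : ℕ) : ℕ := if n = 2 then 1 else 0

/-- The region of integration in the explicit formula for the density; the coordinate `p k` with
`k : Fin n` is the coefficient of `t ^ (k + 1)`. -/
def region (n : ℕ) (t : ℝ) : Set (Fin n → ℝ) :=
  {p | (∀ k, |p k| ≤ 1) ∧ |∑ k, p k * t ^ ((k : ℕ) + 1)| ≤ 1}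

/-- The remainder of the counting function with respect to a density `φ`. -/
def remainder (n : ℕ) (φ : ℝ → ℝ) (Q : ℝ) (I : Set ℝ) : ℝ :=
  (count n Q I : ℝ) - Q ^ (n + 1) / (2 * (riemannZeta ((n : ℂ) + 1)).re) * ∫ x in I, φ x

end RealAlgebraic

end

/-!
The number of roots in `I` of all integral polynomials of height at most `Q` is a sum over the
lattice points of a cube. Along every line parallel to a coordinate axis the root count is a sum of
boundedly many indicator functions of intervals, because `h + x X ^ j` vanishes at `t ≠ 0` exactly
when `x = -h(t) / t ^ j`, a function with boundedly many intervals of monotonicity. Hence the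
lattice sum differs from the integral by `O(Q ^ n)`, and substituting the root for the constant
coefficient (the Kac–Rice formula) turns the integral into `Q ^ (n + 1) ∫ φₙ` over `I`.

Möbius inversion restricts the sum to primitive polynomials, at the cost of the factor
`1 / ζ(n + 1)`. Reducible polynomials are negligible: by Mahler's inequality the height is
multiplicative up to a constant, so the factors of a reducible polynomial of height at most `Q`
have heights of product `O(Q)`, which leaves `O(Q ^ n)` polynomials, with an extra logarithm for
`n = 2`. The irreducible ones come in pairs `±p`, whence the factor `1 / 2`.

The remainder cannot be improved because an algebraic number of degree `n ≥ 2` and height at most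
`Q` has distance at least a constant times `1 / Q` from a fixed rational number: on such a gap the
count vanishes, whereas the main term has order `Q ^ n`.
-/

noncomputable section

open Polynomial

namespace RealAlgebraic

/-! ### Sums of indicator functions of intervals -/

/-- `f` is a sum of at most `N` indicator functions of intervals. Intervals are encoded as
order-connected sets, which may be empty or unbounded, and are indexed by an arbitrary finite
set. -/
def IsIntervalSum (N : ℕ) (f : ℝ → ℝ) : Prop :=
  ∃ (ι : Type) (S : Finset ι) (A : ι → Set ℝ), S.card ≤ N ∧ (∀ i, (A i).OrdConnected) ∧
    ∀ x, f x = ∑ i ∈ S, (A i).indicator 1 x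

section IntervalSum

variable {A : Set ℝ} {N : ℕ} {f : ℝ → ℝ} {s : ℝ}

theorem card_filter_enter_le_one (hA : A.OrdConnected) (hs0 : 0 ≤ s) (hs1 : s ≤ 1) (K : Finset ℤ)
    [DecidablePred fun k : ℤ => (k : ℝ) ∉ A ∧ (k : ℝ) + s ∈ A] :
    (K.filter fun k : ℤ => (k : ℝ) ∉ A ∧ (k : ℝ) + s ∈ A).card ≤ 1 := by
  have not_lt_of_mem : ∀ {k l : ℤ}, (k : ℝ) + s ∈ A → (l : ℝ) ∉ A → (l : ℝ) + s ∈ A → ¬ k < l := by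
    intro k l hk hl hls hkl
    have : (k : ℝ) + 1 ≤ l := by exact_mod_cast hkl
    exact hl (hA.out hk hls ⟨by linarith, by linarith⟩)
  refine Finset.card_le_one.2 fun k hk l hl => ?_
  obtain ⟨-, hk, hks⟩ := Finset.mem_filter.1 hk
  obtain ⟨-, hl, hls⟩ := Finset.mem_filter.1 hl
  exact le_antisymm (not_lt.1 (not_lt_of_mem hls hk hks)) (not_lt.1 (not_lt_of_mem hks hl hls))

theorem card_filter_leave_le_one (hA : A.OrdConnected) (hs0 : 0 ≤ s) (hs1 : s ≤ 1) (K : Finset ℤ)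
    [DecidablePred fun k : ℤ => (k : ℝ) ∈ A ∧ (k : ℝ) + s ∉ A] :
    (K.filter fun k : ℤ => (k : ℝ) ∈ A ∧ (k : ℝ) + s ∉ A).card ≤ 1 := by
  have not_lt_of_mem : ∀ {k l : ℤ}, (k : ℝ) ∈ A → (k : ℝ) + s ∉ A → (l : ℝ) ∈ A → ¬ k < l := by
    intro k l hk hks hl hkl
    have : (k : ℝ) + 1 ≤ l := by exact_mod_cast hkl
    exact hks (hA.out hk hl ⟨by linarith, by linarith⟩)
  refine Finset.card_le_one.2 fun k hk l hl => ?_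
  obtain ⟨-, hk, hks⟩ := Finset.mem_filter.1 hk
  obtain ⟨-, hl, hls⟩ := Finset.mem_filter.1 hl
  exact le_antisymm (not_lt.1 (not_lt_of_mem hl hls hk)) (not_lt.1 (not_lt_of_mem hk hks hl))

theorem sum_abs_indicator_shift_sub_le (hA : A.OrdConnected) (hs0 : 0 ≤ s) (hs1 : s ≤ 1)
    (K : Finset ℤ) :
    ∑ k ∈ K, |A.indicator (1 : ℝ → ℝ) (k + s) - A.indicator 1 (k : ℝ)| ≤ 2 := by
  classical
  have abs_eq : ∀ k : ℤ, |A.indicator (1 : ℝ → ℝ) (k + s) - A.indicator 1 (k : ℝ)| =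
      (if (k : ℝ) ∉ A ∧ (k : ℝ) + s ∈ A then 1 else 0) +
        (if (k : ℝ) ∈ A ∧ (k : ℝ) + s ∉ A then 1 else 0) := fun k => by
    by_cases hk : (k : ℝ) ∈ A <;> by_cases hks : (k : ℝ) + s ∈ A <;> simp [hk, hks]
  rw [Finset.sum_congr rfl fun k _ => abs_eq k, Finset.sum_add_distrib, Finset.sum_boole,
    Finset.sum_boole]
  exact_mod_cast Nat.add_le_add (card_filter_enter_le_one hA hs0 hs1 K)
    (card_filter_leave_le_one hA hs0 hs1 K)

namespace IsIntervalSum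

theorem zero : IsIntervalSum N fun _ => 0 :=
  ⟨Empty, ∅, fun _ => ∅, by simp, fun _ => Set.ordConnected_empty, by simp⟩

theorem indicator (hf : IsIntervalSum N f) (hA : A.OrdConnected) :
    IsIntervalSum N (A.indicator f) := by
  obtain ⟨ι, S, B, hS, hB, hfB⟩ := hf
  refine ⟨ι, S, fun i => A ∩ B i, hS, fun i => hA.inter (hB i), fun x => ?_⟩
  by_cases hx : x ∈ A
  · rw [Set.indicator_of_mem hx, hfB]
    exact Finset.sum_congr rfl fun i _ => Set.indicator_eq_indicator (by simp [hx]) rfl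
  · rw [Set.indicator_of_notMem hx, Finset.sum_eq_zero]
    exact fun i _ => Set.indicator_of_notMem (fun h => hx h.1) _

theorem sum_abs_shift_sub_le (hf : IsIntervalSum N f) (hs0 : 0 ≤ s) (hs1 : s ≤ 1)
    (K : Finset ℤ) : ∑ k ∈ K, |f (k + s) - f k| ≤ 2 * N := by
  obtain ⟨ι, S, A, hS, hA, hfA⟩ := hf
  simp only [hfA, ← Finset.sum_sub_distrib]
  calc ∑ k ∈ K, |∑ i ∈ S, ((A i).indicator 1 (k + s) - (A i).indicator 1 (k : ℝ))|
      ≤ ∑ k ∈ K, ∑ i ∈ S, |(A i).indicator (1 : ℝ → ℝ) (k + s) - (A i).indicator 1 (k : ℝ)| :=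
        Finset.sum_le_sum fun k _ => Finset.abs_sum_le_sum_abs _ _
    _ = ∑ i ∈ S, ∑ k ∈ K, |(A i).indicator (1 : ℝ → ℝ) (k + s) - (A i).indicator 1 (k : ℝ)| :=
        Finset.sum_comm
    _ ≤ ∑ _i ∈ S, (2 : ℝ) :=
        Finset.sum_le_sum fun i _ => sum_abs_indicator_shift_sub_le (hA i) hs0 hs1 K
    _ = 2 * S.card := by rw [Finset.sum_const, nsmul_eq_mul, mul_comm]
    _ ≤ 2 * N := by gcongr

theorem measurable (hf : IsIntervalSum N f) : Measurable f := by
  obtain ⟨ι, S, A, -, hA, hfA⟩ := hf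
  rw [funext hfA]
  exact Finset.measurable_sum _ fun i _ => measurable_one.indicator (hA i).measurableSet

theorem abs_le (hf : IsIntervalSum N f) (x : ℝ) : |f x| ≤ N := by
  obtain ⟨ι, S, A, hS, -, hfA⟩ := hf
  have nonneg : ∀ i ∈ S, 0 ≤ (A i).indicator (1 : ℝ → ℝ) x := fun i _ =>
    Set.indicator_nonneg (fun _ _ => zero_le_one) x
  have le_one : ∀ i ∈ S, (A i).indicator (1 : ℝ → ℝ) x ≤ 1 := fun i _ =>
    Set.indicator_le_self' (fun _ _ => zero_le_one) x
  rw [hfA, abs_of_nonneg (Finset.sum_nonneg nonneg)]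
  refine (Finset.sum_le_card_nsmul _ _ _ le_one).trans ?_
  simpa using hS

theorem integrable (hf : IsIntervalSum N f) {Q : ℝ} (hsupp : ∀ x, f x ≠ 0 → |x| ≤ Q) :
    Integrable f := by
  have hon : IntegrableOn f (Set.Icc (-Q) Q) :=
    Measure.integrableOn_of_bounded (M := N) measure_Icc_lt_top.ne
      hf.measurable.aestronglyMeasurable (ae_of_all _ fun x => hf.abs_le x)
  exact (integrableOn_iff_integrable_of_support_subset fun x hx =>
    Set.mem_Icc.2 (_root_.abs_le.1 (hsupp x hx))).1 hon

end IsIntervalSum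

end IntervalSum

/-! ### Lattice sums and integrals -/

/-- The integer vectors of length `m` with entries of absolute value at most `B`. -/
def latticeBox (m B : ℕ) : Finset (Fin m → ℤ) :=
  Fintype.piFinset fun _ => Finset.Icc (-(B : ℤ)) B

/-- The embedding of the integer vectors into the real vectors. -/
def intVec {m : ℕ} (k : Fin m → ℤ) : Fin m → ℝ := fun i => (k i : ℝ)

/-- The closed cube of the vectors of sup norm at most `Q`; it is empty for `Q < 0` (if `0 < n`). -/
def cube (n : ℕ) (Q : ℝ) : Set (Fin n → ℝ) := Set.Icc (fun _ => -Q) fun _ => Q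

/-- The half-open unit cube, a fundamental domain of the integer lattice. -/
def unitCube (n : ℕ) : Set (Fin n → ℝ) := Set.univ.pi fun _ => Set.Ico 0 1

/-- On every line parallel to a coordinate axis, `F` is a sum of at most `N` indicator functions
of intervals. This is the regularity under which lattice sums are close to integrals. -/
def IsLinewiseIntervalSum {m : ℕ} (N : ℕ) (F : (Fin m → ℝ) → ℝ) : Prop :=
  ∀ v j, IsIntervalSum N fun x => F (Function.update v j x)

section Lattice

variable {m n B N : ℕ} {Q : ℝ}

theorem mem_latticeBox {k : Fin m → ℤ} : k ∈ latticeBox m B ↔ ∀ i, |k i| ≤ B := by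
  simp [latticeBox, Fintype.mem_piFinset, abs_le]

theorem card_latticeBox (m B : ℕ) : (latticeBox m B).card = (2 * B + 1) ^ m := by
  rw [latticeBox, Fintype.card_piFinset]
  simp only [Int.card_Icc, Finset.prod_const, Finset.card_univ, Fintype.card_fin]
  congr 1
  omega

theorem sum_latticeBox_succ {M : Type*} [AddCommMonoid M] (j : Fin (m + 1))
    (f : (Fin (m + 1) → ℤ) → M) : ∑ k ∈ latticeBox (m + 1) B, f k =
      ∑ r ∈ latticeBox m B, ∑ x ∈ Finset.Icc (-(B : ℤ)) B, f (j.insertNth x r) := by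
  rw [Finset.sum_comm, ← Finset.sum_product' (f := fun x r => f (j.insertNth x r))]
  symm
  refine Finset.sum_equiv (Fin.insertNthEquiv (fun _ => ℤ) j) ?_ ?_
  · rintro ⟨x, r⟩
    simp [mem_latticeBox, Fin.forall_iff_succAbove j, abs_le]
  · rintro ⟨x, r⟩ _
    rfl

theorem intVec_insertNth_add_update (j : Fin (n + 1)) (r : Fin n → ℤ) (x : ℤ)
    (c : Fin (n + 1) → ℝ) (a : ℝ) :
    intVec (j.insertNth x r : Fin (n + 1) → ℤ) + Function.update c j a =
      Function.update (intVec (j.insertNth 0 r : Fin (n + 1) → ℤ) + c) j (x + a) := by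
  ext i
  rcases eq_or_ne i j with rfl | hi
  · simp [intVec]
  · obtain ⟨i', rfl⟩ := Fin.exists_succAbove_eq hi
    simp [intVec]

theorem intVec_cons_add_cons (x : ℤ) (r : Fin n → ℤ) (a : ℝ) (s : Fin n → ℝ) :
    intVec (Fin.cons x r : Fin (n + 1) → ℤ) + (Fin.cons a s : Fin (n + 1) → ℝ) =
      (Fin.cons (x + a) (intVec r + s) : Fin (n + 1) → ℝ) := by
  ext i
  refine Fin.cases ?_ (fun i => ?_) i <;> simp [intVec]

theorem mem_cube {p : Fin n → ℝ} : p ∈ cube n Q ↔ ∀ k, |p k| ≤ Q := by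
  simp [cube, Set.mem_Icc, Pi.le_def, abs_le, forall_and]

theorem cons_mem_cube {x : ℝ} {q : Fin n → ℝ} :
    (Fin.cons x q : Fin (n + 1) → ℝ) ∈ cube (n + 1) Q ↔ |x| ≤ Q ∧ q ∈ cube n Q := by
  simp [mem_cube, Fin.forall_fin_succ]

theorem intVec_mem_cube_iff (hQ : 0 ≤ Q) {k : Fin m → ℤ} :
    intVec k ∈ cube m Q ↔ k ∈ latticeBox m ⌊Q⌋₊ := by
  rw [mem_latticeBox, mem_cube]
  refine forall_congr' fun i => ?_
  rw [Int.abs_eq_natAbs, Nat.cast_le, Nat.le_floor_iff hQ, intVec, Nat.cast_natAbs, Int.cast_abs]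

theorem latticeBox_mono {C : ℕ} (hBC : B ≤ C) : latticeBox m B ⊆ latticeBox m C := fun k hk => by
  rw [mem_latticeBox] at hk ⊢
  exact fun i => (hk i).trans (by exact_mod_cast hBC)

theorem integrable_cube_indicator (Q c : ℝ) :
    Integrable ((cube n Q).indicator fun _ => c) := by
  rw [integrable_indicator_iff (by exact measurableSet_Icc)]
  exact integrableOn_const isCompact_Icc.measure_lt_top.ne

theorem measurableSet_unitCube (n : ℕ) : MeasurableSet (unitCube n) :=
  MeasurableSet.univ_pi fun _ => measurableSet_Ico

theorem volume_unitCube (n : ℕ) : volume (unitCube n) = 1 := by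
  simp [unitCube, volume_pi_pi]

theorem sub_intCast_mem_Ico_iff {x : ℝ} {k : ℤ} : x - k ∈ Set.Ico (0 : ℝ) 1 ↔ ⌊x⌋ = k := by
  rw [Int.floor_eq_iff, Set.mem_Ico]
  constructor <;> rintro ⟨h1, h2⟩ <;> constructor <;> linarith

theorem floor_mem_Icc_ceil {x : ℝ} (hx : |x| ≤ Q) :
    ⌊x⌋ ∈ Finset.Icc (-(⌈Q⌉₊ : ℤ)) ⌈Q⌉₊ := by
  obtain ⟨hxl, hxr⟩ := abs_le.1 hx
  have hQ := Nat.le_ceil Q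
  rw [Finset.mem_Icc, Int.le_floor, ← Int.cast_le (R := ℝ)]
  push_cast
  exact ⟨by linarith, by linarith [Int.floor_le x]⟩

theorem IsLinewiseIntervalSum.indicator_cube {F : (Fin n → ℝ) → ℝ}
    (hF : IsLinewiseIntervalSum N F) : IsLinewiseIntervalSum N ((cube n Q).indicator F) :=
  fun v j => (hF v j).indicator
    ((Set.ordConnected_Icc (a := fun _ => -Q) (b := fun _ => Q)).preimage_mono
      (Function.update_mono (f := v) (i := j)))

theorem IsLinewiseIntervalSum.isIntervalSum_cons {F : (Fin (n + 1) → ℝ) → ℝ}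
    (hF : IsLinewiseIntervalSum N F) (q : Fin n → ℝ) :
    IsIntervalSum N fun x => F (Fin.cons x q) := by
  simpa only [Fin.update_cons_zero] using hF (Fin.cons 0 q) 0

theorem IsLinewiseIntervalSum.abs_sum_update_sub_le {F : (Fin (n + 1) → ℝ) → ℝ}
    (hF : IsLinewiseIntervalSum N F) (c : Fin (n + 1) → ℝ) (j : Fin (n + 1)) {s : ℝ} (hs0 : 0 ≤ s)
    (hs1 : s ≤ 1) :
    |∑ k ∈ latticeBox (n + 1) B, F (intVec k + Function.update c j s) -
      ∑ k ∈ latticeBox (n + 1) B, F (intVec k + Function.update c j 0)| ≤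
      2 * N * (2 * B + 1) ^ n := by
  simp only [sum_latticeBox_succ j, intVec_insertNth_add_update, add_zero,
    ← Finset.sum_sub_distrib]
  calc _ ≤ ∑ _r ∈ latticeBox n B, (2 * N : ℝ) := by
        refine (Finset.abs_sum_le_sum_abs _ _).trans (Finset.sum_le_sum fun r _ => ?_)
        exact (Finset.abs_sum_le_sum_abs _ _).trans ((hF _ j).sum_abs_shift_sub_le hs0 hs1 _)
    _ = _ := by
        rw [Finset.sum_const, card_latticeBox, nsmul_eq_mul]; push_cast; ring

theorem IsLinewiseIntervalSum.abs_sum_piecewise_sub_le {F : (Fin (n + 1) → ℝ) → ℝ}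
    (hF : IsLinewiseIntervalSum N F) {s : Fin (n + 1) → ℝ} (hs0 : ∀ i, 0 ≤ s i)
    (hs1 : ∀ i, s i ≤ 1) (T : Finset (Fin (n + 1))) :
    |∑ k ∈ latticeBox (n + 1) B, F (intVec k + T.piecewise s 0) -
      ∑ k ∈ latticeBox (n + 1) B, F (intVec k)| ≤ T.card * (2 * N * (2 * B + 1) ^ n) := by
  induction T using Finset.induction_on with
  | empty => simp
  | insert j T hj ih =>
    have hzero : Function.update (T.piecewise s 0) j 0 = T.piecewise s 0 := by
      rw [Function.update_eq_self_iff, Finset.piecewise_eq_of_notMem _ _ _ hj, Pi.zero_apply]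
    have hstep := hF.abs_sum_update_sub_le (B := B) (T.piecewise s 0) j (hs0 j) (hs1 j)
    rw [hzero, ← Finset.piecewise_insert] at hstep
    rw [Finset.card_insert_of_notMem hj]
    push_cast
    linarith [abs_sub_le (∑ k ∈ latticeBox (n + 1) B, F (intVec k + (insert j T).piecewise s 0))
      (∑ k ∈ latticeBox (n + 1) B, F (intVec k + T.piecewise s 0))
      (∑ k ∈ latticeBox (n + 1) B, F (intVec k))]

theorem IsLinewiseIntervalSum.abs_sum_sub_sum_add_le {F : (Fin (n + 1) → ℝ) → ℝ}
    (hF : IsLinewiseIntervalSum N F) {s : Fin (n + 1) → ℝ} (hs0 : ∀ i, 0 ≤ s i)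
    (hs1 : ∀ i, s i ≤ 1) :
    |∑ k ∈ latticeBox (n + 1) B, F (intVec k) - ∑ k ∈ latticeBox (n + 1) B, F (intVec k + s)| ≤
      (n + 1) * (2 * N * (2 * B + 1) ^ n) := by
  have h := hF.abs_sum_piecewise_sub_le (B := B) hs0 hs1 Finset.univ
  rw [abs_sub_comm]
  simpa using h

theorem integral_eq_sum_translates {E ι : Type*} [AddCommGroup E] [MeasurableSpace E]
    [MeasurableAdd E] {μ : Measure E} [μ.IsAddLeftInvariant] {D : Set E} (hD : MeasurableSet D)
    (L : Finset ι) (c : ι → E)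
    (hdisj : (L : Set ι).Pairwise fun a b => ∀ x, x - c a ∈ D → x - c b ∉ D) {f : E → ℝ}
    (hf : Integrable f μ) (hsupp : ∀ x, f x ≠ 0 → ∃ a ∈ L, x - c a ∈ D) :
    ∫ x, f x ∂μ = ∑ a ∈ L, ∫ s in D, f (c a + s) ∂μ := by
  have hmeas : ∀ a, MeasurableSet {x | x - c a ∈ D} := fun a => by
    simp only [sub_eq_add_neg]
    exact measurable_add_const _ hD
  have htranslate : ∀ a, ∫ s in D, f (c a + s) ∂μ = ∫ x in {x | x - c a ∈ D}, f x ∂μ := fun a => by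
    rw [← integral_indicator hD, ← integral_indicator (hmeas a),
      ← integral_add_left_eq_self ({x | x - c a ∈ D}.indicator f) (c a)]
    congr 1 with x
    classical
    simp only [Set.indicator_apply, Set.mem_ofPred_eq, add_sub_cancel_left]
  rw [Finset.sum_congr rfl fun a _ => htranslate a,
    ← integral_biUnion_finset _ (fun a _ => hmeas a) ?_ (fun a _ => hf.integrableOn)]
  · refine (setIntegral_eq_integral_of_forall_compl_eq_zero fun x hx => ?_).symm
    by_contra h
    obtain ⟨a, ha, hxa⟩ := hsupp x h
    exact hx (Set.mem_iUnion₂.2 ⟨a, ha, hxa⟩)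
  · exact fun a ha b hb hab => Set.disjoint_left.2 fun x hxa hxb => hdisj ha hb hab x hxa hxb

theorem integral_eq_sum_Ico {f : ℝ → ℝ} (hf : Integrable f) (hsupp : ∀ x, f x ≠ 0 → |x| ≤ Q) :
    ∫ x, f x = ∑ k ∈ Finset.Icc (-(⌈Q⌉₊ : ℤ)) ⌈Q⌉₊, ∫ s in Set.Ico (0 : ℝ) 1, f (k + s) := by
  refine integral_eq_sum_translates measurableSet_Ico _ (fun k : ℤ => (k : ℝ)) ?_ hf fun x hx =>
    ⟨⌊x⌋, floor_mem_Icc_ceil (hsupp x hx), sub_intCast_mem_Ico_iff.2 rfl⟩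
  exact fun a _ b _ hab x ha hb =>
    hab ((sub_intCast_mem_Ico_iff.1 ha).symm.trans (sub_intCast_mem_Ico_iff.1 hb))

theorem integral_eq_sum_unitCube {f : (Fin n → ℝ) → ℝ} (hf : Integrable f)
    (hsupp : ∀ x, f x ≠ 0 → x ∈ cube n Q) :
    ∫ x, f x = ∑ k ∈ latticeBox n ⌈Q⌉₊, ∫ s in unitCube n, f (intVec k + s) := by
  refine integral_eq_sum_translates (measurableSet_unitCube n) _ intVec ?_ hf fun x hx =>
    ⟨fun i => ⌊x i⌋, ?_, fun i _ => sub_intCast_mem_Ico_iff.2 rfl⟩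
  · exact fun a _ b _ hab x ha hb => hab (funext fun i =>
      (sub_intCast_mem_Ico_iff.1 (ha i trivial)).symm.trans
        (sub_intCast_mem_Ico_iff.1 (hb i trivial)))
  · rw [latticeBox, Fintype.mem_piFinset]
    exact fun i => floor_mem_Icc_ceil (mem_cube.1 (hsupp x hx) i)

theorem abs_sub_setIntegral_le {E : Type*} [MeasurableSpace E] {μ : Measure E} {D : Set E}
    (hD : μ D = 1) {f : E → ℝ} (hf : IntegrableOn f D μ) {a C : ℝ}
    (h : ∀ s ∈ D, |a - f s| ≤ C) : |a - ∫ s in D, f s ∂μ| ≤ C := by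
  have integral_const : a = ∫ _ in D, a ∂μ := by simp [Measure.real, hD]
  have integrable_const : IntegrableOn (fun _ => a) D μ := integrableOn_const (by simp [hD])
  rw [integral_const, ← integral_sub integrable_const hf]
  simpa [Measure.real, hD] using norm_setIntegral_le_of_norm_le_const (μ := μ) (s := D)
    (f := fun s => a - f s) (C := C) (by simp [hD]) h

section LatticeSum

variable {F : (Fin (n + 1) → ℝ) → ℝ}

theorem IsLinewiseIntervalSum.integrable_cons (hF : IsLinewiseIntervalSum N F)
    (hsupp : ∀ v, F v ≠ 0 → v ∈ cube (n + 1) Q) (q : Fin n → ℝ) :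
    Integrable fun x => F (Fin.cons x q) :=
  (hF.isIntervalSum_cons q).integrable fun _ hx => (cons_mem_cube.1 (hsupp _ hx)).1

theorem IsLinewiseIntervalSum.abs_sum_sub_sum_integral_cons_le
    (hF : IsLinewiseIntervalSum N F) (hsupp : ∀ v, F v ≠ 0 → v ∈ cube (n + 1) Q)
    {s : Fin n → ℝ} (hs : s ∈ unitCube n) :
    |∑ k ∈ latticeBox (n + 1) ⌈Q⌉₊, F (intVec k) -
      ∑ r ∈ latticeBox n ⌈Q⌉₊, ∫ x, F (Fin.cons x (intVec r + s))| ≤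
      (n + 1) * (2 * N * (2 * ⌈Q⌉₊ + 1) ^ n) := by
  have hint : ∀ (q : Fin n → ℝ) (x : ℤ),
      IntegrableOn (fun a : ℝ => F (Fin.cons (x + a) q)) (Set.Ico 0 1) := fun q x =>
    ((hF.integrable_cons hsupp q).comp_add_left (x : ℝ)).integrableOn
  have integral_cons : ∀ q : Fin n → ℝ, ∫ x, F (Fin.cons x q) = ∫ a in Set.Ico (0 : ℝ) 1,
      ∑ x ∈ Finset.Icc (-(⌈Q⌉₊ : ℤ)) ⌈Q⌉₊, F (Fin.cons (x + a) q) := fun q => by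
    rw [integral_finsetSum _ fun x _ => hint q x]
    exact integral_eq_sum_Ico (hF.integrable_cons hsupp q) fun x hx =>
      (cons_mem_cube.1 (hsupp _ hx)).1
  simp only [integral_cons]
  rw [← integral_finsetSum _ fun r _ => integrable_finsetSum _ fun x _ => hint _ x]
  refine abs_sub_setIntegral_le (by simp)
    (integrable_finsetSum _ fun r _ => integrable_finsetSum _ fun x _ => hint _ x) fun a ha => ?_
  have hshift := hF.abs_sum_sub_sum_add_le (B := ⌈Q⌉₊) (s := (Fin.cons a s : Fin (n + 1) → ℝ))
    (Fin.cases ha.1 fun i => (hs i trivial).1) (Fin.cases ha.2.le fun i => (hs i trivial).2.le)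
  rw [sum_latticeBox_succ 0
    (fun k => F (intVec k + (Fin.cons a s : Fin (n + 1) → ℝ)))] at hshift
  simpa only [Fin.insertNth_zero', intVec_cons_add_cons] using hshift

/-- The integral is iterated, so that `F` need not be jointly measurable. -/
theorem IsLinewiseIntervalSum.abs_sum_sub_integral_le (hF : IsLinewiseIntervalSum N F)
    (hsupp : ∀ v, F v ≠ 0 → v ∈ cube (n + 1) Q)
    (hint : Integrable fun q : Fin n → ℝ => ∫ x, F (Fin.cons x q)) :
    |∑ k ∈ latticeBox (n + 1) ⌈Q⌉₊, F (intVec k) - ∫ q : Fin n → ℝ, ∫ x, F (Fin.cons x q)| ≤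
      (n + 1) * (2 * N * (2 * ⌈Q⌉₊ + 1) ^ n) := by
  have hsupp_integral : ∀ q : Fin n → ℝ, ∫ x, F (Fin.cons x q) ≠ 0 → q ∈ cube n Q := by
    intro q hq
    by_contra hmem
    refine hq (integral_eq_zero_of_ae (ae_of_all _ fun x => ?_))
    by_contra hx
    exact hmem (cons_mem_cube.1 (hsupp _ hx)).2
  have hint_shift : ∀ r ∈ latticeBox n ⌈Q⌉₊,
      IntegrableOn (fun s => ∫ x, F (Fin.cons x (intVec r + s))) (unitCube n) := fun r _ =>
    (hint.comp_add_left (intVec r)).integrableOn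
  rw [integral_eq_sum_unitCube hint hsupp_integral, ← integral_finsetSum _ hint_shift]
  exact abs_sub_setIntegral_le (volume_unitCube n) (integrable_finsetSum _ hint_shift)
    fun s hs => hF.abs_sum_sub_sum_integral_cons_le hsupp hs

end LatticeSum

end Lattice

/-! ### The density -/

/-- The value at `t` of `p₁ t + … + pₙ tⁿ`; as in `region`, the entry `p k` with `k : Fin n` is the
coefficient of `t ^ (k + 1)`. -/
def tailEval {n : ℕ} (p : Fin n → ℝ) (t : ℝ) : ℝ := ∑ k : Fin n, p k * t ^ ((k : ℕ) + 1)

/-- The derivative in `t` of `tailEval p t`. -/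
def tailDeriv {n : ℕ} (p : Fin n → ℝ) (t : ℝ) : ℝ := ∑ k : Fin n, ((k : ℝ) + 1) * p k * t ^ (k : ℕ)

open Classical in
/-- The Kac–Rice integrand: the density of the roots at `t` of the polynomials with coefficients in
`[-Q, Q]` and given nonconstant coefficients `p`. Such a polynomial vanishes at `t` iff its constant
coefficient is `-tailEval p t`, which must lie in `[-Q, Q]`. -/
def kernel {n : ℕ} (Q : ℝ) (p : Fin n → ℝ) (t : ℝ) : ℝ :=
  if (∀ k, |p k| ≤ Q) ∧ |tailEval p t| ≤ Q then |tailDeriv p t| else 0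

/-- The density `φₙ` of the real algebraic numbers of degree `n`. -/
def density (n : ℕ) (t : ℝ) : ℝ := ∫ p : Fin n → ℝ, kernel 1 p t

section Density

variable {n : ℕ} {Q : ℝ}

theorem continuous_tailEval : Continuous fun x : (Fin n → ℝ) × ℝ => tailEval x.1 x.2 := by
  unfold tailEval; fun_prop

theorem continuous_tailDeriv : Continuous fun x : (Fin n → ℝ) × ℝ => tailDeriv x.1 x.2 := by
  unfold tailDeriv; fun_prop

theorem kernel_nonneg (Q : ℝ) (p : Fin n → ℝ) (t : ℝ) : 0 ≤ kernel Q p t := by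
  unfold kernel; split_ifs <;> positivity

theorem measurable_kernel (Q : ℝ) :
    Measurable fun x : (Fin n → ℝ) × ℝ => kernel Q x.1 x.2 := by
  have hclosed :
      IsClosed {x : (Fin n → ℝ) × ℝ | (∀ k, |x.1 k| ≤ Q) ∧ |tailEval x.1 x.2| ≤ Q} := by
    rw [Set.ofPred_and, Set.ofPred_forall]
    exact (isClosed_iInter fun k => isClosed_le (by fun_prop) continuous_const).inter
      (isClosed_le continuous_tailEval.abs continuous_const)
  exact Measurable.ite hclosed.measurableSet continuous_tailDeriv.abs.measurable measurable_const

theorem isClosed_region (n : ℕ) (t : ℝ) : IsClosed (region n t) := by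
  unfold region
  rw [Set.ofPred_and, Set.ofPred_forall]
  exact (isClosed_iInter fun k => isClosed_le (by fun_prop) continuous_const).inter
    (isClosed_le (by fun_prop) continuous_const)

theorem density_eq_integral_region (n : ℕ) (t : ℝ) :
    density n t = ∫ p in region n t, |∑ k : Fin n, ((k : ℝ) + 1) * p k * t ^ (k : ℕ)| := by
  classical
  rw [← integral_indicator (isClosed_region n t).measurableSet, density]
  congr 1 with p
  rw [Set.indicator_apply, kernel]
  exact if_congr Iff.rfl rfl rfl

theorem density_nonneg (t : ℝ) : 0 ≤ density n t :=
  integral_nonneg fun _ => kernel_nonneg _ _ _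

theorem abs_tailDeriv_le {t T : ℝ} {p : Fin n → ℝ} (hp : ∀ k, |p k| ≤ Q) (ht : |t| ≤ T) :
    |tailDeriv p t| ≤ Q * ∑ k : Fin n, ((k : ℝ) + 1) * T ^ (k : ℕ) := by
  rw [tailDeriv, Finset.mul_sum]
  refine (Finset.abs_sum_le_sum_abs _ _).trans (Finset.sum_le_sum fun k _ => ?_)
  have hQ : 0 ≤ Q := (abs_nonneg _).trans (hp k)
  calc |((k : ℝ) + 1) * p k * t ^ (k : ℕ)| = ((k : ℝ) + 1) * |p k| * |t| ^ (k : ℕ) := by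
        rw [abs_mul, abs_mul, abs_pow, abs_of_nonneg (by positivity : (0 : ℝ) ≤ (k : ℝ) + 1)]
    _ ≤ ((k : ℝ) + 1) * Q * T ^ (k : ℕ) := by
        gcongr
        exact hp k
    _ = Q * (((k : ℝ) + 1) * T ^ (k : ℕ)) := by ring

theorem kernel_le_indicator {t T : ℝ} (p : Fin n → ℝ) (ht : |t| ≤ T) :
    kernel Q p t ≤ (cube n Q).indicator
      (fun _ => Q * ∑ k : Fin n, ((k : ℝ) + 1) * T ^ (k : ℕ)) p := by
  by_cases hp : p ∈ cube n Q
  · have hle := abs_tailDeriv_le (mem_cube.1 hp) ht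
    rw [Set.indicator_of_mem hp, kernel]
    split_ifs
    · exact hle
    · exact (abs_nonneg _).trans hle
  · rw [Set.indicator_of_notMem hp, kernel, if_neg fun h => hp (mem_cube.2 h.1)]

theorem integrable_kernel (Q t : ℝ) : Integrable fun p : Fin n → ℝ => kernel Q p t := by
  refine (integrable_cube_indicator Q (Q * ∑ k : Fin n, ((k : ℝ) + 1) * |t| ^ (k : ℕ))).mono'
    ((measurable_kernel Q).comp (measurable_id.prodMk measurable_const)).aestronglyMeasurable
    (ae_of_all _ fun p => ?_)
  rw [Real.norm_of_nonneg (kernel_nonneg _ _ _)]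
  exact kernel_le_indicator p le_rfl

theorem tailEval_smul (c : ℝ) (p : Fin n → ℝ) (t : ℝ) : tailEval (c • p) t = c * tailEval p t := by
  simp [tailEval, Finset.mul_sum, mul_assoc]

theorem tailDeriv_smul (c : ℝ) (p : Fin n → ℝ) (t : ℝ) :
    tailDeriv (c • p) t = c * tailDeriv p t := by
  simp only [tailDeriv, Finset.mul_sum, Pi.smul_apply, smul_eq_mul]
  exact Finset.sum_congr rfl fun k _ => by ring

theorem kernel_smul (hQ : 0 < Q) (p : Fin n → ℝ) (t : ℝ) :
    kernel Q (Q • p) t = Q * kernel 1 p t := by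
  have abs_mul_le_iff : ∀ x : ℝ, |Q * x| ≤ Q ↔ |x| ≤ 1 := fun x => by
    rw [abs_mul, abs_of_pos hQ, mul_le_iff_le_one_right hQ]
  simp only [kernel, tailEval_smul, tailDeriv_smul, abs_mul_le_iff, Pi.smul_apply, smul_eq_mul,
    abs_mul Q (tailDeriv p t), abs_of_pos hQ, mul_ite, mul_zero]

theorem integral_kernel (hQ : 0 < Q) (t : ℝ) :
    ∫ p : Fin n → ℝ, kernel Q p t = Q ^ (n + 1) * density n t := by
  have h := Measure.integral_comp_smul (volume : Measure (Fin n → ℝ)) (fun p => kernel Q p t) Q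
  simp only [kernel_smul hQ, Module.finrank_fin_fun, integral_const_mul, smul_eq_mul] at h
  rw [abs_of_pos (by positivity)] at h
  rw [pow_succ, mul_assoc, density, h, ← mul_assoc, mul_inv_cancel₀ (by positivity), one_mul]

theorem volume_tailEval_eq (t : ℝ) {c : ℝ} (hc : c ≠ 0) :
    volume {p : Fin n → ℝ | tailEval p t = c} = 0 := by
  let l : (Fin n → ℝ) →ₗ[ℝ] ℝ := ∑ k : Fin n, (t ^ ((k : ℕ) + 1)) • LinearMap.proj k
  have hl : ∀ p, l p = tailEval p t := fun p => by simp [l, tailEval, mul_comm]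
  let s : AffineSubspace ℝ (Fin n → ℝ) := (affineSpan ℝ {c}).comap l.toAffineMap
  have hs : (s : Set (Fin n → ℝ)) = {p | tailEval p t = c} := by
    ext p; simp [s, hl]
  rw [← hs]
  refine Measure.addHaar_affineSubspace _ s fun htop => hc ?_
  have zero_mem : (0 : Fin n → ℝ) ∈ (s : Set (Fin n → ℝ)) := by rw [htop]; trivial
  rw [hs] at zero_mem
  simpa [tailEval] using zero_mem.symm

theorem ae_abs_tailEval_ne_one (t : ℝ) : ∀ᵐ p : Fin n → ℝ, |tailEval p t| ≠ 1 := by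
  have hpos : ∀ᵐ p : Fin n → ℝ, tailEval p t ≠ 1 := by
    rw [ae_iff]; simpa using volume_tailEval_eq (n := n) t one_ne_zero
  have hneg : ∀ᵐ p : Fin n → ℝ, tailEval p t ≠ -1 := by
    rw [ae_iff]; simpa using volume_tailEval_eq (n := n) t (c := -1) (by norm_num)
  filter_upwards [hpos, hneg] with p hp1 hp2 h
  exact ((abs_eq zero_le_one).1 h).elim hp1 hp2

theorem continuousAt_kernel {p : Fin n → ℝ} {t : ℝ} (h : |tailEval p t| ≠ 1) :
    ContinuousAt (fun x => kernel 1 p x) t := by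
  have hE : Continuous fun x => |tailEval p x| :=
    (continuous_tailEval.comp (continuous_const.prodMk continuous_id)).abs
  have hD : Continuous fun x => |tailDeriv p x| :=
    (continuous_tailDeriv.comp (continuous_const.prodMk continuous_id)).abs
  by_cases hp : ∀ k, |p k| ≤ 1
  · rcases lt_or_gt_of_ne h with h | h
    · refine hD.continuousAt.congr ?_
      filter_upwards [hE.continuousAt.eventually_lt_const h] with x hx
      rw [kernel, if_pos ⟨hp, hx.le⟩]
    · refine (continuousAt_const (y := (0 : ℝ))).congr ?_
      filter_upwards [hE.continuousAt.eventually_const_lt h] with x hx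
      rw [kernel, if_neg fun H => hx.not_ge H.2]
  · have kernel_eq_zero : (fun x => kernel 1 p x) = fun _ => 0 := by
      ext x; rw [kernel, if_neg fun H => hp H.1]
    rw [kernel_eq_zero]
    exact continuousAt_const

theorem continuous_density (n : ℕ) : Continuous (density n) := by
  refine continuous_iff_continuousAt.2 fun t => ?_
  refine continuousAt_of_dominated (bound := (cube n 1).indicator
      (fun _ => 1 * ∑ k : Fin n, ((k : ℝ) + 1) * (|t| + 1) ^ (k : ℕ)))
    (Eventually.of_forall fun x => (integrable_kernel 1 x).aestronglyMeasurable) ?_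
    (integrable_cube_indicator _ _)
    ((ae_abs_tailEval_ne_one t).mono fun p hp => continuousAt_kernel hp)
  have abs_lt : ∀ᶠ x in 𝓝 t, |x| < |t| + 1 :=
    continuous_abs.continuousAt.eventually_lt_const (by linarith)
  filter_upwards [abs_lt] with x hx
  refine ae_of_all _ fun p => ?_
  rw [Real.norm_of_nonneg (kernel_nonneg _ _ _)]
  exact kernel_le_indicator p hx.le

theorem tailEval_single (i : Fin n) (a t : ℝ) :
    tailEval (Pi.single i a) t = a * t ^ ((i : ℕ) + 1) := by
  rw [tailEval, Finset.sum_eq_single i (fun b _ hb => by simp [hb]) (by simp), Pi.single_eq_same]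

theorem tailDeriv_single (i : Fin n) (a t : ℝ) :
    tailDeriv (Pi.single i a) t = ((i : ℝ) + 1) * a * t ^ (i : ℕ) := by
  rw [tailDeriv, Finset.sum_eq_single i (fun b _ hb => by simp [hb]) (by simp), Pi.single_eq_same]

theorem exists_abs_lt_one_tailDeriv_ne_zero (hn : 1 ≤ n) (t : ℝ) :
    ∃ p : Fin n → ℝ, (∀ k, |p k| < 1) ∧ |tailEval p t| < 1 ∧ tailDeriv p t ≠ 0 := by
  have ht := abs_nonneg t
  let a : ℝ := 1 / (|t| + 2)
  have ha : 0 < a := by positivity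
  have ha1 : a < 1 := by
    rw [div_lt_one (by linarith)]; linarith
  refine ⟨Pi.single ⟨0, hn⟩ a, fun k => ?_, ?_, ?_⟩
  · rcases eq_or_ne k ⟨0, hn⟩ with rfl | hk
    · simpa [abs_of_pos ha] using ha1
    · simp [hk]
  · rw [tailEval_single, zero_add, pow_one, abs_mul, abs_of_pos ha, div_mul_eq_mul_div,
      div_lt_one (by linarith)]
    linarith
  · simpa [tailDeriv_single] using ha.ne'

theorem density_pos (hn : 1 ≤ n) (t : ℝ) : 0 < density n t := by
  have hE : Continuous fun p : Fin n → ℝ => |tailEval p t| :=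
    (continuous_tailEval.comp (continuous_id.prodMk continuous_const)).abs
  have hD : Continuous fun p : Fin n → ℝ => tailDeriv p t :=
    continuous_tailDeriv.comp (continuous_id.prodMk continuous_const)
  let U : Set (Fin n → ℝ) := {p | (∀ k, |p k| < 1) ∧ |tailEval p t| < 1 ∧ tailDeriv p t ≠ 0}
  have hU : IsOpen U := by
    simp only [U, Set.ofPred_and, Set.ofPred_forall]
    exact (isOpen_iInter_of_finite fun k => isOpen_lt (by fun_prop) continuous_const).inter
      ((isOpen_lt hE continuous_const).inter (isOpen_ne_fun hD continuous_const))
  rw [density, integral_pos_iff_support_of_nonneg (fun p => kernel_nonneg _ _ _)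
    (integrable_kernel 1 t)]
  refine (hU.measure_pos volume (exists_abs_lt_one_tailDeriv_ne_zero hn t)).trans_le
    (measure_mono fun p hp => ?_)
  obtain ⟨hcoeff, heval, hderiv⟩ := hp
  rw [Function.mem_support, kernel, if_pos ⟨fun k => (hcoeff k).le, heval.le⟩]
  exact abs_ne_zero.2 hderiv

/-! ### Symmetries of the density -/

theorem integral_comp_mul_of_abs_eq_one {ι : Type*} [Fintype ι] {ε : ι → ℝ} (hε : ∀ i, |ε i| = 1)
    (F : (ι → ℝ) → ℝ) : ∫ p : ι → ℝ, F (fun i => ε i * p i) = ∫ p, F p := by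
  have hne : ∀ i, ε i ≠ 0 := fun i h => by simpa [h] using hε i
  have hpres : MeasurePreserving fun p : ι → ℝ => fun i => ε i * p i := by
    refine volume_preserving_pi fun i => ?_
    rcases (abs_eq zero_le_one).1 (hε i) with h | h
    · rw [h, show HMul.hMul (1 : ℝ) = id from funext one_mul]
      exact MeasurePreserving.id _
    · rw [h, show HMul.hMul (-1 : ℝ) = Neg.neg from funext neg_one_mul]
      exact Measure.measurePreserving_neg _
  exact hpres.integral_comp
    (Homeomorph.piCongrRight fun i => Homeomorph.mulLeft₀ (ε i) (hne i)).measurableEmbedding F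

theorem tailEval_alternating_neg (p : Fin n → ℝ) (t : ℝ) :
    tailEval (fun k : Fin n => (-1) ^ ((k : ℕ) + 1) * p k) (-t) = tailEval p t := by
  refine Finset.sum_congr rfl fun k _ => ?_
  rw [mul_right_comm, ← mul_pow, neg_one_mul, neg_neg, mul_comm]

theorem tailDeriv_alternating_neg (p : Fin n → ℝ) (t : ℝ) :
    tailDeriv (fun k : Fin n => (-1) ^ ((k : ℕ) + 1) * p k) (-t) = -tailDeriv p t := by
  rw [tailDeriv, tailDeriv, ← Finset.sum_neg_distrib]
  refine Finset.sum_congr rfl fun k _ => ?_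
  have hsign : (-1 : ℝ) ^ (k : ℕ) * (-t) ^ (k : ℕ) = t ^ (k : ℕ) := by
    rw [← mul_pow, neg_one_mul, neg_neg]
  rw [pow_succ]
  linear_combination -((k : ℝ) + 1) * p k * hsign

theorem density_neg (t : ℝ) : density n (-t) = density n t := by
  have hε : ∀ k : Fin n, |(-1 : ℝ) ^ ((k : ℕ) + 1)| = 1 := fun k => by simp
  rw [density, density, ← integral_comp_mul_of_abs_eq_one hε]
  simp only [kernel, tailEval_alternating_neg, tailDeriv_alternating_neg, abs_neg, abs_mul, hε,
    one_mul]

theorem integral_fin_snoc {m : ℕ} {F : (Fin (m + 1) → ℝ) → ℝ} (hF : Integrable F) :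
    ∫ p, F p = ∫ q : Fin m → ℝ, ∫ u : ℝ, F (Fin.snoc (α := fun _ => ℝ) q u) := by
  let e := (MeasurableEquiv.piFinSuccAbove (fun _ : Fin (m + 1) => ℝ) (Fin.last m)).symm
  have he : MeasurePreserving e :=
    (volume_preserving_piFinSuccAbove (fun _ : Fin (m + 1) => ℝ) (Fin.last m)).symm _
  have he_apply : ∀ (u : ℝ) (q : Fin m → ℝ), e (u, q) = Fin.snoc (α := fun _ => ℝ) q u :=
    fun u q => by simp [e, Fin.snocEquiv]
  have hint : Integrable fun x => F (e x) := (he.integrable_comp_emb e.measurableEmbedding).2 hF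
  rw [← he.integral_comp', Measure.volume_eq_prod, integral_prod_symm _ hint]
  simp only [he_apply]

theorem integral_comp_equiv {ι ι' : Type*} [Fintype ι] [Fintype ι'] (σ : ι ≃ ι')
    (F : (ι → ℝ) → ℝ) : ∫ q : ι' → ℝ, F (q ∘ σ) = ∫ q : ι → ℝ, F q :=
  (volume_preserving_arrowCongr' σ.symm (MeasurableEquiv.refl ℝ)
    (MeasurePreserving.id volume)).integral_comp' F

theorem tailEval_snoc {m : ℕ} (q : Fin m → ℝ) (u t : ℝ) :
    tailEval (Fin.snoc (α := fun _ => ℝ) q u) t = tailEval q t + u * t ^ (m + 1) := by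
  simp [tailEval, Fin.sum_univ_castSucc]

theorem tailDeriv_snoc {m : ℕ} (q : Fin m → ℝ) (u t : ℝ) :
    tailDeriv (Fin.snoc (α := fun _ => ℝ) q u) t = tailDeriv q t + (m + 1) * u * t ^ m := by
  simp [tailDeriv, Fin.sum_univ_castSucc]

theorem tailEval_rev {m : ℕ} (q : Fin m → ℝ) {t : ℝ} (ht : t ≠ 0) :
    t ^ (m + 1) * tailEval (q ∘ Fin.revPerm) (1 / t) = tailEval q t := by
  rw [tailEval, tailEval, Finset.mul_sum, ← Equiv.sum_comp Fin.revPerm]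
  refine Finset.sum_congr rfl fun k _ => ?_
  have hk : (m + 1 : ℕ) = ((k.rev : ℕ) + 1) + (k + 1) := by
    rw [Fin.val_rev]; omega
  rw [Function.comp_apply, Fin.revPerm_apply, Fin.revPerm_apply, Fin.rev_rev, hk, pow_add, one_div,
    inv_pow]
  field_simp

theorem tailDeriv_rev {m : ℕ} (q : Fin m → ℝ) {t : ℝ} (ht : t ≠ 0) :
    t ^ m * tailDeriv (q ∘ Fin.revPerm) (1 / t) = (m + 1) * tailEval q t - t * tailDeriv q t := by
  rw [tailEval, tailDeriv, tailDeriv, Finset.mul_sum, Finset.mul_sum, Finset.mul_sum,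
    ← Finset.sum_sub_distrib, ← Equiv.sum_comp Fin.revPerm]
  refine Finset.sum_congr rfl fun k _ => ?_
  have hk : (m : ℕ) = (k.rev : ℕ) + (k + 1) := by
    rw [Fin.val_rev]; omega
  have hk_cast : ((k.rev : ℕ) : ℝ) = m - k - 1 := by
    have : (m : ℝ) = (k.rev : ℕ) + (k + 1) := by exact_mod_cast hk
    linarith
  have hpow : t ^ m * (1 / t) ^ (k.rev : ℕ) = t ^ ((k : ℕ) + 1) := by
    rw [show t ^ m = t ^ ((k.rev : ℕ) + (k + 1)) from congrArg _ hk, pow_add, one_div, inv_pow]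
    field_simp
  rw [Function.comp_apply, Fin.revPerm_apply, Fin.revPerm_apply, Fin.rev_rev, hk_cast]
  linear_combination ((m : ℝ) - k) * q k * hpow

/-- Reversing `a₀ + a₁ t + … + aₙ tⁿ` exchanges the roots `t` and `1 / t`. On the hyperplane of the
polynomials vanishing at `t`, the constant coefficient is a function of the others, and after the
reversal it is the leading one. -/
theorem kernel_snoc_rev {m : ℕ} (q : Fin m → ℝ) (u : ℝ) {t : ℝ} (ht : t ≠ 0) :
    |t| ^ m * kernel 1 (Fin.snoc (α := fun _ => ℝ) (q ∘ Fin.revPerm)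
      (-t ^ (m + 1) * u - tailEval q t)) (1 / t) =
      |t| * kernel 1 (Fin.snoc (α := fun _ => ℝ) q u) t := by
  set u' := -t ^ (m + 1) * u - tailEval q t with hu'
  have hpow : t ^ m * (1 / t) ^ m = 1 := by rw [← mul_pow, mul_one_div_cancel ht, one_pow]
  have heval : tailEval (Fin.snoc (α := fun _ => ℝ) (q ∘ Fin.revPerm) u') (1 / t) = -u := by
    rw [tailEval_snoc, hu', ← tailEval_rev q ht, one_div_pow]
    field_simp
    ring
  have hderiv : t ^ m * tailDeriv (Fin.snoc (α := fun _ => ℝ) (q ∘ Fin.revPerm) u') (1 / t) =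
      -(t * tailDeriv (Fin.snoc (α := fun _ => ℝ) q u) t) := by
    rw [tailDeriv_snoc, tailDeriv_snoc, mul_add, tailDeriv_rev q ht]
    linear_combination (m + 1) * u' * hpow + (m + 1) * hu'
  have hlead : |u'| = |tailEval (Fin.snoc (α := fun _ => ℝ) q u) t| := by
    rw [tailEval_snoc, ← abs_neg, hu']; ring_nf
  have hcoeff : (∀ i, |q (Fin.revPerm i)| ≤ 1) ↔ ∀ i, |q i| ≤ 1 :=
    Fin.revPerm.forall_congr_left.trans (by simp)
  simp only [kernel, mul_ite, mul_zero]
  rw [heval, ← abs_pow, ← abs_mul, ← abs_mul, hderiv, abs_neg (t * _)]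
  refine if_congr ?_ rfl rfl
  simp only [Fin.forall_fin_succ', Fin.snoc_castSucc, Fin.snoc_last, hlead, Function.comp_apply,
    hcoeff, abs_neg]
  tauto

theorem integral_kernel_snoc_rev {m : ℕ} (q : Fin m → ℝ) {t : ℝ} (ht : t ≠ 0) :
    ∫ u : ℝ, kernel 1 (Fin.snoc (α := fun _ => ℝ) (q ∘ Fin.revPerm) u) (1 / t) =
      t ^ 2 * ∫ u : ℝ, kernel 1 (Fin.snoc (α := fun _ => ℝ) q u) t := by
  let G : ℝ → ℝ := fun u => kernel 1 (Fin.snoc (α := fun _ => ℝ) (q ∘ Fin.revPerm) u) (1 / t)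
  have hsub : |t| ^ (m + 1) * ∫ u, G (-t ^ (m + 1) * u - tailEval q t) = ∫ u, G u := by
    rw [Measure.integral_comp_mul_left (fun u => G (u - tailEval q t)) (-t ^ (m + 1)),
      integral_sub_right_eq_self G, smul_eq_mul, abs_inv, abs_neg, abs_pow, ← mul_assoc,
      mul_inv_cancel₀ (pow_ne_zero _ (abs_ne_zero.2 ht)), one_mul]
  calc ∫ u, G u = |t| * ∫ u, |t| ^ m * G (-t ^ (m + 1) * u - tailEval q t) := by
        rw [← hsub, integral_const_mul, pow_succ]; ring
    _ = |t| * ∫ u, |t| * kernel 1 (Fin.snoc (α := fun _ => ℝ) q u) t := by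
        simp only [G, kernel_snoc_rev q _ ht]
    _ = t ^ 2 * ∫ u, kernel 1 (Fin.snoc (α := fun _ => ℝ) q u) t := by
        rw [integral_const_mul, ← mul_assoc, ← sq, sq_abs]

theorem sq_mul_density (hn : 1 ≤ n) {t : ℝ} (ht : t ≠ 0) :
    t ^ 2 * density n t = density n (1 / t) := by
  obtain ⟨m, rfl⟩ : ∃ m, n = m + 1 := ⟨n - 1, by omega⟩
  rw [density, density, integral_fin_snoc (integrable_kernel _ _),
    integral_fin_snoc (integrable_kernel _ _), ← integral_const_mul,
    ← integral_comp_equiv Fin.revPerm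
      fun q => ∫ u, kernel 1 (Fin.snoc (α := fun _ => ℝ) q u) (1 / t)]
  simp only [integral_kernel_snoc_rev _ ht]

theorem integrable_density (hn : 1 ≤ n) : Integrable (density n) := by
  obtain ⟨C, hC⟩ := (isCompact_Icc (a := (-1 : ℝ)) (b := 1)).exists_bound_of_continuousOn
    (continuous_density n).continuousOn
  have density_le : ∀ x : ℝ, |x| ≤ 1 → density n x ≤ C := fun x hx =>
    (le_abs_self _).trans (hC x (abs_le.1 hx))
  have hC0 : 0 ≤ C := (density_nonneg _).trans (density_le 0 (by simp))
  refine ((integrable_inv_one_add_sq).const_mul (2 * C)).mono'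
    (continuous_density n).aestronglyMeasurable (ae_of_all _ fun x => ?_)
  rw [Real.norm_of_nonneg (density_nonneg _), ← div_eq_mul_inv, le_div_iff₀ (by positivity)]
  rcases le_total |x| 1 with h | h
  · have hx : x ^ 2 ≤ 1 := by rw [← sq_abs]; exact pow_le_one₀ (abs_nonneg x) h
    nlinarith [density_nonneg (n := n) x, density_le x h]
  · have hx0 : x ≠ 0 := abs_pos.1 (zero_lt_one.trans_le h)
    have hinv : density n (1 / x) ≤ C := density_le (1 / x) (by
      rw [abs_div, abs_one]; exact div_le_one_of_le₀ h (abs_nonneg x))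
    have hx : 1 ≤ x ^ 2 := by rw [← sq_abs]; exact one_le_pow₀ h
    nlinarith [density_nonneg (n := n) x, sq_mul_density hn hx0]

theorem integrable_kernel_prod (hn : 1 ≤ n) (hQ : 0 < Q) (I : Set ℝ) :
    Integrable (fun x : (Fin n → ℝ) × ℝ => kernel Q x.1 x.2)
      (volume.prod (volume.restrict I)) := by
  rw [integrable_prod_iff' (measurable_kernel Q).aestronglyMeasurable]
  refine ⟨ae_of_all _ fun t => integrable_kernel Q t, ?_⟩
  simp only [Real.norm_of_nonneg (kernel_nonneg _ _ _), integral_kernel hQ]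
  exact ((integrable_density hn).const_mul _).restrict

theorem integral_setIntegral_kernel (hn : 1 ≤ n) (hQ : 0 < Q) (I : Set ℝ) :
    ∫ q : Fin n → ℝ, ∫ t in I, kernel Q q t = Q ^ (n + 1) * ∫ t in I, density n t := by
  rw [integral_integral_swap (integrable_kernel_prod hn hQ I)]
  simp only [integral_kernel hQ, integral_const_mul]

end Density

/-! ### Roots along a line of coefficients -/

theorem natDegree_ofFn_le {R : Type*} [Semiring R] [DecidableEq R] {n : ℕ} (v : Fin (n + 1) → R) :
    (ofFn (n + 1) v).natDegree ≤ n :=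
  Nat.lt_succ_iff.1 (ofFn_natDegree_lt n.succ_pos v)

theorem ofFn_update {R : Type*} [Semiring R] [DecidableEq R] {m : ℕ} (v : Fin m → R) (j : Fin m)
    (x : R) : ofFn m (Function.update v j x) =
      ofFn m (Function.update v j 0) + monomial (j : ℕ) x := by
  ext i
  rw [coeff_add, coeff_monomial]
  rcases lt_or_ge i m with hi | hi
  · rw [ofFn_coeff_eq_val_of_lt _ hi, ofFn_coeff_eq_val_of_lt _ hi]
    obtain rfl | hij := eq_or_ne j ⟨i, hi⟩
    · simp
    · rw [Function.update_of_ne hij.symm, Function.update_of_ne hij.symm,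
        if_neg fun h => hij (Fin.ext h), add_zero]
  · rw [ofFn_coeff_eq_zero_of_ge _ hi, ofFn_coeff_eq_zero_of_ge _ hi, if_neg (by omega), add_zero]

open Classical in
/-- The number of distinct nonzero roots of `p` in `I`. The zero polynomial counts as having
none. The root `0` is left out because a coefficient other than the constant one cannot be
recovered from it, see `solution`. -/
def rootCount (I : Set ℝ) (p : ℝ[X]) : ℕ := (p.roots.toFinset.filter fun t => t ∈ I ∧ t ≠ 0).card

theorem rootCount_le_natDegree (I : Set ℝ) (p : ℝ[X]) : rootCount I p ≤ p.natDegree := by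
  classical
  exact (Finset.card_filter_le _ _).trans ((Multiset.toFinset_card_le _).trans (card_roots' p))

theorem rootCount_zero (I : Set ℝ) : rootCount I 0 = 0 := by simp [rootCount]

theorem rootCount_smul (I : Set ℝ) {c : ℝ} (hc : c ≠ 0) (p : ℝ[X]) :
    rootCount I (c • p) = rootCount I p := by
  rw [rootCount, rootCount, smul_eq_C_mul, roots_C_mul _ hc]

theorem rootCount_monomial (I : Set ℝ) (j : ℕ) (x : ℝ) : rootCount I (monomial j x) = 0 := by
  classical
  rw [rootCount, Finset.card_eq_zero, Finset.filter_eq_empty_iff]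
  rintro t ht ⟨-, ht0⟩
  obtain ⟨hne, hroot⟩ := mem_roots'.1 (Multiset.mem_toFinset.1 ht)
  rw [IsRoot.def, eval_monomial] at hroot
  exact hne (by rw [(mul_eq_zero.1 hroot).resolve_right (pow_ne_zero _ ht0), map_zero])

/-- A monotone labelling of `ℝ` that takes different values on the elements of `Z` and on the gaps
between them. -/
def level (Z : Finset ℝ) (t : ℝ) : ℕ := (Z.filter (· < t)).card + (Z.filter (· ≤ t)).card

theorem level_mono (Z : Finset ℝ) : Monotone (level Z) := fun _ _ hab =>
  add_le_add
    (Finset.card_le_card (Finset.monotone_filter_right _ fun _ _ hz => lt_of_lt_of_le hz hab))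
    (Finset.card_le_card (Finset.monotone_filter_right _ fun _ _ hz => le_trans hz hab))

theorem level_le (Z : Finset ℝ) (t : ℝ) : level Z t ≤ 2 * Z.card := by
  rw [two_mul]
  exact add_le_add (Finset.card_filter_le _ _) (Finset.card_filter_le _ _)

theorem level_lt {Z : Finset ℝ} {a b z : ℝ} (hz : z ∈ Z) (hab : a < b) (haz : a ≤ z)
    (hzb : z ≤ b) : level Z a < level Z b := by
  have filter_lt_subset : Z.filter (· < a) ⊆ Z.filter (· < b) :=
    Finset.monotone_filter_right _ fun _ _ hy => lt_trans hy hab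
  have filter_le_subset : Z.filter (· ≤ a) ⊆ Z.filter (· ≤ b) :=
    Finset.monotone_filter_right _ fun _ _ hy => le_trans hy hab.le
  rcases haz.eq_or_lt with rfl | haz
  · refine add_lt_add_of_lt_of_le (Finset.card_lt_card ⟨filter_lt_subset, fun h => ?_⟩)
      (Finset.card_le_card filter_le_subset)
    exact lt_irrefl _ (Finset.mem_filter.1 (h (Finset.mem_filter.2 ⟨hz, hab⟩))).2
  · refine add_lt_add_of_le_of_lt (Finset.card_le_card filter_lt_subset)
      (Finset.card_lt_card ⟨filter_le_subset, fun h => ?_⟩)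
    exact haz.not_ge (Finset.mem_filter.1 (h (Finset.mem_filter.2 ⟨hz, hzb⟩))).2

/-- The polynomial whose nonzero roots are the critical points of `t ↦ h(t) / t ^ j`. -/
def critical (h : ℝ[X]) (j : ℕ) : ℝ[X] := X * derivative h - C (j : ℝ) * h

open Classical in
/-- The points that separate the intervals of monotonicity of `t ↦ h(t) / t ^ j`. -/
def breakPoints (h : ℝ[X]) (j : ℕ) : Finset ℝ := insert 0 (critical h j).roots.toFinset

/-- The value of `x` for which `h + x X ^ j` vanishes at `t ≠ 0`. -/
def solution (h : ℝ[X]) (j : ℕ) (t : ℝ) : ℝ := -(h.eval t) / t ^ j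

/-- The `i`-th of the parts of `I \ {0}` on each of which `solution h j` is injective. -/
def branch (h : ℝ[X]) (j : ℕ) (I : Set ℝ) (i : ℕ) : Set ℝ :=
  {t | t ∈ I ∧ t ≠ 0 ∧ level (breakPoints h j) t = i}

section Branch

variable {h : ℝ[X]} {j n : ℕ} {I : Set ℝ}

theorem coeff_critical (h : ℝ[X]) (j i : ℕ) :
    (critical h j).coeff i = ((i : ℝ) - j) * h.coeff i := by
  rw [critical, coeff_sub, coeff_C_mul]
  cases i with
  | zero => simp
  | succ i => rw [coeff_X_mul, coeff_derivative]; push_cast; ring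

theorem natDegree_critical_le (h : ℝ[X]) (j : ℕ) : (critical h j).natDegree ≤ h.natDegree :=
  natDegree_le_iff_coeff_eq_zero.2 fun i hi => by
    rw [coeff_critical, coeff_eq_zero_of_natDegree_lt hi, mul_zero]

theorem critical_eq_zero_iff : critical h j = 0 ↔ h = monomial j (h.coeff j) := by
  simp only [Polynomial.ext_iff, coeff_critical, coeff_zero, mul_eq_zero, sub_eq_zero, Nat.cast_inj,
    coeff_monomial]
  refine forall_congr' fun i => ?_
  obtain rfl | hij := eq_or_ne i j
  · simp
  · simp [hij, hij.symm]

theorem zero_mem_breakPoints (h : ℝ[X]) (j : ℕ) : (0 : ℝ) ∈ breakPoints h j :=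
  Finset.mem_insert_self _ _

theorem card_breakPoints_le (h : ℝ[X]) (j : ℕ) : (breakPoints h j).card ≤ h.natDegree + 1 :=
  (Finset.card_insert_le _ _).trans (Nat.succ_le_succ ((Multiset.toFinset_card_le _).trans
    ((card_roots' _).trans (natDegree_critical_le h j))))

theorem hasDerivAt_solution (h : ℝ[X]) (j : ℕ) {t : ℝ} (ht : t ≠ 0) :
    HasDerivAt (solution h j) (-(critical h j).eval t / t ^ (j + 1)) t := by
  convert! (h.hasDerivAt t).neg.div (hasDerivAt_pow j t) (pow_ne_zero _ ht) using 1
  simp only [critical, eval_sub, eval_mul, eval_X, eval_C, Pi.neg_apply]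
  cases j with
  | zero => simp; field_simp
  | succ j => field_simp; simp; ring

theorem eval_add_monomial_eq_zero_iff (h : ℝ[X]) (j : ℕ) {t : ℝ} (ht : t ≠ 0) (x : ℝ) :
    (h + monomial j x).eval t = 0 ↔ solution h j t = x := by
  rw [eval_add, eval_monomial, solution, div_eq_iff (pow_ne_zero j ht), neg_eq_iff_add_eq_zero]

theorem not_mem_breakPoints_of_mem_branch {i : ℕ} {a b z : ℝ} (ha : a ∈ branch h j I i)
    (hb : b ∈ branch h j I i) (hab : a < b) (haz : a ≤ z) (hzb : z ≤ b) :
    z ∉ breakPoints h j := fun hz =>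
  (level_lt hz hab haz hzb).ne (ha.2.2.trans hb.2.2.symm)

theorem ordConnected_branch (hI : I.OrdConnected) (i : ℕ) : (branch h j I i).OrdConnected := by
  refine ⟨fun a ha b hb c hc => ⟨hI.out ha.1 hb.1 hc, ?_, le_antisymm ?_ ?_⟩⟩
  · rintro rfl
    obtain rfl | hab := (hc.1.trans hc.2).eq_or_lt
    · exact ha.2.1 (le_antisymm hc.1 hc.2)
    · exact not_mem_breakPoints_of_mem_branch ha hb hab hc.1 hc.2 (zero_mem_breakPoints h j)
  · exact (level_mono _ hc.2).trans_eq hb.2.2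
  · exact ha.2.2.ge.trans (level_mono _ hc.1)

theorem solution_ne_of_lt (hcrit : critical h j ≠ 0) {i : ℕ} {a b : ℝ} (ha : a ∈ branch h j I i)
    (hb : b ∈ branch h j I i) (hab : a < b) : solution h j a ≠ solution h j b := fun heq => by
  have ne_zero : ∀ t ∈ Set.Icc a b, t ≠ 0 := fun t ht h0 =>
    not_mem_breakPoints_of_mem_branch ha hb hab ht.1 ht.2 (h0 ▸ zero_mem_breakPoints h j)
  obtain ⟨c, hc, hc0⟩ := exists_hasDerivAt_eq_zero hab
    (fun t ht => (hasDerivAt_solution h j (ne_zero t ht)).continuousAt.continuousWithinAt) heq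
    (fun t ht => hasDerivAt_solution h j (ne_zero t (Set.Ioo_subset_Icc_self ht)))
  have hroot : (critical h j).eval c = 0 := by
    simpa [div_eq_zero_iff, ne_zero c (Set.Ioo_subset_Icc_self hc)] using hc0
  exact not_mem_breakPoints_of_mem_branch ha hb hab hc.1.le hc.2.le
    (Finset.mem_insert_of_mem (Multiset.mem_toFinset.2 ((mem_roots hcrit).2 hroot)))

theorem injOn_solution (hcrit : critical h j ≠ 0) (i : ℕ) :
    Set.InjOn (solution h j) (branch h j I i) := fun a ha b hb heq => by
  by_contra hne
  rcases lt_or_gt_of_ne hne with hab | hba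
  · exact solution_ne_of_lt hcrit ha hb hab heq
  · exact solution_ne_of_lt hcrit hb ha hba heq.symm

theorem ordConnected_image_branch (hI : I.OrdConnected) (i : ℕ) :
    (solution h j '' branch h j I i).OrdConnected :=
  ((ordConnected_branch hI i).isPreconnected.image _ fun _ ht =>
    (hasDerivAt_solution h j ht.2.1).continuousAt.continuousWithinAt).ordConnected

theorem mem_roots_add_monomial_iff (hcrit : critical h j ≠ 0) {t : ℝ} (ht : t ≠ 0) (x : ℝ) :
    t ∈ (h + monomial j x).roots ↔ solution h j t = x := by
  have hne : h + monomial j x ≠ 0 := fun h0 => hcrit <| by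
    rw [critical_eq_zero_iff, eq_neg_of_add_eq_zero_left h0, ← map_neg, coeff_monomial_same]
  rw [mem_roots hne, IsRoot.def, eval_add_monomial_eq_zero_iff h j ht]

theorem rootCount_add_monomial_eq_sum (hcrit : critical h j ≠ 0) (I : Set ℝ) (x : ℝ) :
    (rootCount I (h + monomial j x) : ℝ) = ∑ i ∈ Finset.range (2 * (breakPoints h j).card + 1),
      (solution h j '' branch h j I i).indicator 1 x := by
  classical
  rw [rootCount, Finset.card_eq_sum_card_fiberwise (f := level (breakPoints h j))
    (t := Finset.range (2 * (breakPoints h j).card + 1))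
    (fun t _ => Finset.mem_coe.2 (Finset.mem_range_succ_iff.2 (level_le _ _))), Nat.cast_sum]
  refine Finset.sum_congr rfl fun i _ => ?_
  have mem_fibre : ∀ t, t ∈ ((h + monomial j x).roots.toFinset.filter fun t => t ∈ I ∧ t ≠ 0).filter
      (fun t => level (breakPoints h j) t = i) ↔ t ∈ branch h j I i ∧ solution h j t = x := by
    intro t
    simp only [Finset.mem_filter, Multiset.mem_toFinset, branch, Set.mem_ofPred_eq]
    constructor
    · rintro ⟨⟨hroot, htI, ht⟩, hi⟩
      exact ⟨⟨htI, ht, hi⟩, (mem_roots_add_monomial_iff hcrit ht x).1 hroot⟩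
    · rintro ⟨⟨htI, ht, hi⟩, hsol⟩
      exact ⟨⟨(mem_roots_add_monomial_iff hcrit ht x).2 hsol, htI, ht⟩, hi⟩
  by_cases hx : x ∈ solution h j '' branch h j I i
  · rw [Set.indicator_of_mem hx, Pi.one_apply, Nat.cast_eq_one, Finset.card_eq_one]
    obtain ⟨t, ht, hsol⟩ := hx
    refine ⟨t, Finset.ext fun s => ?_⟩
    rw [mem_fibre, Finset.mem_singleton]
    exact ⟨fun hs => injOn_solution hcrit i hs.1 ht (hs.2.trans hsol.symm),
      fun hs => hs ▸ ⟨ht, hsol⟩⟩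
  · rw [Set.indicator_of_notMem hx, Nat.cast_eq_zero, Finset.card_eq_zero]
    exact Finset.eq_empty_of_forall_notMem fun t ht => hx ⟨t, (mem_fibre t).1 ht⟩

theorem isIntervalSum_rootCount_add_monomial (hI : I.OrdConnected) (hn : h.natDegree ≤ n) (j : ℕ) :
    IsIntervalSum (2 * n + 3) fun x => (rootCount I (h + monomial j x) : ℝ) := by
  by_cases hcrit : critical h j = 0
  · have hmon : ∀ x, h + monomial j x = monomial j (h.coeff j + x) := fun x => by
      rw [map_add, ← critical_eq_zero_iff.1 hcrit]
    simpa only [hmon, rootCount_monomial, Nat.cast_zero] using IsIntervalSum.zero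
  · refine ⟨ℕ, _, _, ?_, ordConnected_image_branch hI, rootCount_add_monomial_eq_sum hcrit I⟩
    have := card_breakPoints_le h j
    rw [Finset.card_range]
    omega

theorem isLinewiseIntervalSum_rootCount (hI : I.OrdConnected) :
    IsLinewiseIntervalSum (2 * n + 3)
      fun v : Fin (n + 1) → ℝ => (rootCount I (ofFn (n + 1) v) : ℝ) := fun v j => by
  simpa only [← ofFn_update v j] using
    isIntervalSum_rootCount_add_monomial hI (natDegree_ofFn_le (Function.update v j 0)) j

end Branch

/-! ### The Kac–Rice formula in the constant coefficient -/

section KacRice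

variable {h : ℝ[X]} {I : Set ℝ} {w : ℝ → ℝ} {n : ℕ} {Q : ℝ}

theorem solution_zero (h : ℝ[X]) (t : ℝ) : solution h 0 t = -h.eval t := by simp [solution]

theorem hasDerivAt_solution_zero (h : ℝ[X]) (t : ℝ) :
    HasDerivAt (solution h 0) (-h.derivative.eval t) t := by
  rw [funext (solution_zero h)]
  exact (h.hasDerivAt t).neg

theorem biUnion_branch (h : ℝ[X]) (j : ℕ) (I : Set ℝ) :
    ⋃ i ∈ Finset.range (2 * (breakPoints h j).card + 1), branch h j I i = I \ {0} := by
  ext t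
  simp only [Set.mem_iUnion, exists_prop, branch, Set.mem_ofPred_eq, Set.mem_sdiff,
    Set.mem_singleton_iff]
  exact ⟨fun ⟨_, _, htI, ht, _⟩ => ⟨htI, ht⟩,
    fun ⟨htI, ht⟩ => ⟨_, Finset.mem_range_succ_iff.2 (level_le _ t), htI, ht, rfl⟩⟩

theorem pairwise_disjoint_branch (h : ℝ[X]) (j : ℕ) (I : Set ℝ) :
    Pairwise (Function.onFun Disjoint (branch h j I)) := fun _ _ hik =>
  Set.disjoint_left.2 fun _ hi hk => hik (hi.2.2.symm.trans hk.2.2)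

theorem integral_indicator_image_branch (hI : I.OrdConnected) (hcrit : critical h 0 ≠ 0) (i : ℕ) :
    ∫ x, (solution h 0 '' branch h 0 I i).indicator w x =
      ∫ t in branch h 0 I i, |h.derivative.eval t| * w (-h.eval t) := by
  rw [integral_indicator (ordConnected_image_branch hI i).measurableSet,
    integral_image_eq_integral_abs_deriv_smul (ordConnected_branch hI i).measurableSet
      (fun t _ => (hasDerivAt_solution_zero h t).hasDerivWithinAt) (injOn_solution hcrit i)]
  simp only [abs_neg, solution_zero, smul_eq_mul]

theorem integrableOn_branch (hI : I.OrdConnected) (hcrit : critical h 0 ≠ 0) (hw : Integrable w)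
    (i : ℕ) :
    IntegrableOn (fun t => |h.derivative.eval t| * w (-h.eval t)) (branch h 0 I i) := by
  simpa only [abs_neg, solution_zero, smul_eq_mul] using
    (integrableOn_image_iff_integrableOn_abs_deriv_smul (ordConnected_branch hI i).measurableSet
      (fun t _ => (hasDerivAt_solution_zero h t).hasDerivWithinAt) (injOn_solution hcrit i) w).1
      hw.integrableOn

theorem integral_mul_rootCount_add_C (hI : I.OrdConnected) (h : ℝ[X]) (hw : Integrable w) :
    ∫ x, w x * rootCount I (h + C x) = ∫ t in I, |h.derivative.eval t| * w (-h.eval t) := by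
  simp only [← monomial_zero_left]
  by_cases hcrit : critical h 0 = 0
  · obtain ⟨c, rfl⟩ : ∃ c, h = monomial 0 c := ⟨_, critical_eq_zero_iff.1 hcrit⟩
    simp only [← map_add, rootCount_monomial, derivative_monomial, Nat.cast_zero, mul_zero,
      map_zero, eval_zero, abs_zero, zero_mul, integral_zero]
  have integrand_eq : ∀ x, w x * rootCount I (h + monomial 0 x) =
      ∑ i ∈ Finset.range (2 * (breakPoints h 0).card + 1),
        (solution h 0 '' branch h 0 I i).indicator w x := fun x => by
    rw [rootCount_add_monomial_eq_sum hcrit, Finset.mul_sum]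
    refine Finset.sum_congr rfl fun i _ => ?_
    by_cases hx : x ∈ solution h 0 '' branch h 0 I i <;> simp [hx]
  have punctured_ae_eq : (I \ {0} : Set ℝ) =ᵐ[volume] I := sdiff_null_ae_eq_self (by simp)
  rw [integral_congr_ae (ae_of_all _ integrand_eq), integral_finsetSum _ fun i _ =>
      hw.indicator (ordConnected_image_branch hI i).measurableSet,
    Finset.sum_congr rfl fun i _ => integral_indicator_image_branch hI hcrit i,
    ← integral_biUnion_finset _ (fun i _ => (ordConnected_branch hI i).measurableSet)
      ((pairwise_disjoint_branch h 0 I).set_pairwise _)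
      (fun i _ => integrableOn_branch hI hcrit hw i),
    biUnion_branch, setIntegral_congr_set punctured_ae_eq]

theorem eval_ofFn {R : Type*} [CommSemiring R] [DecidableEq R] {m : ℕ} (v : Fin m → R) (t : R) :
    (ofFn m v).eval t = ∑ i : Fin m, v i * t ^ (i : ℕ) := by
  simp [ofFn_eq_sum_monomial, eval_finsetSum]

theorem ofFn_cons (x : ℝ) (q : Fin n → ℝ) :
    ofFn (n + 1) (Fin.cons x q : Fin (n + 1) → ℝ) =
      ofFn (n + 1) (Fin.cons 0 q : Fin (n + 1) → ℝ) + C x := by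
  simpa only [Fin.update_cons_zero, Fin.val_zero, monomial_zero_left] using
    ofFn_update (Fin.cons 0 q : Fin (n + 1) → ℝ) 0 x

theorem eval_ofFn_cons_zero (q : Fin n → ℝ) (t : ℝ) :
    (ofFn (n + 1) (Fin.cons 0 q : Fin (n + 1) → ℝ)).eval t = tailEval q t := by
  simp [eval_ofFn, Fin.sum_univ_succ, tailEval]

theorem hasDerivAt_tailEval (q : Fin n → ℝ) (t : ℝ) :
    HasDerivAt (tailEval q) (tailDeriv q t) t := by
  unfold tailEval tailDeriv
  refine HasDerivAt.fun_sum fun k _ => ?_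
  convert! (hasDerivAt_pow ((k : ℕ) + 1) t).const_mul (q k) using 1
  push_cast
  ring

theorem eval_derivative_ofFn_cons_zero (q : Fin n → ℝ) (t : ℝ) :
    (ofFn (n + 1) (Fin.cons 0 q : Fin (n + 1) → ℝ)).derivative.eval t = tailDeriv q t := by
  refine (Polynomial.hasDerivAt _ t).unique ?_
  simpa only [eval_ofFn_cons_zero] using hasDerivAt_tailEval q t

/-- The number of nonzero roots in `I` of the polynomial with coefficients `v`, cut off to the
coefficient vectors in the cube of side `2 * Q`. -/
def cubeCount (Q : ℝ) (I : Set ℝ) : (Fin (n + 1) → ℝ) → ℝ :=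
  (cube (n + 1) Q).indicator fun v => (rootCount I (ofFn (n + 1) v) : ℝ)

theorem cubeCount_cons {q : Fin n → ℝ} (hq : q ∈ cube n Q) (I : Set ℝ) (x : ℝ) :
    cubeCount Q I (Fin.cons x q) = (Set.Icc (-Q) Q).indicator 1 x *
      rootCount I (ofFn (n + 1) (Fin.cons 0 q : Fin (n + 1) → ℝ) + C x) := by
  classical
  simp only [cubeCount, Set.indicator_apply, cons_mem_cube, hq, and_true, abs_le, Set.mem_Icc,
    Pi.one_apply, boole_mul, ofFn_cons x q]

theorem integral_cubeCount_cons (hI : I.OrdConnected) (Q : ℝ) (q : Fin n → ℝ) :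
    ∫ x, cubeCount Q I (Fin.cons x q) = ∫ t in I, kernel Q q t := by
  classical
  by_cases hq : q ∈ cube n Q
  · have integrable_indicator_Icc : Integrable ((Set.Icc (-Q) Q).indicator (1 : ℝ → ℝ)) :=
      (integrable_indicator_iff measurableSet_Icc).2
        (integrableOn_const isCompact_Icc.measure_lt_top.ne)
    simp only [cubeCount_cons hq]
    rw [integral_mul_rootCount_add_C hI _ integrable_indicator_Icc]
    congr 1 with t
    simp only [eval_derivative_ofFn_cons_zero, eval_ofFn_cons_zero, kernel, mem_cube.1 hq,
      implies_true, true_and, Set.indicator_apply, Set.mem_Icc, ← abs_le, abs_neg, Pi.one_apply,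
      mul_boole]
  · have cubeCount_eq_zero : ∀ x : ℝ, cubeCount Q I (Fin.cons x q) = 0 := fun x =>
      Set.indicator_of_notMem (fun h => hq (cons_mem_cube.1 h).2) _
    have kernel_eq_zero : ∀ t, kernel Q q t = 0 := fun t => if_neg fun h => hq (mem_cube.2 h.1)
    simp only [cubeCount_eq_zero, kernel_eq_zero, integral_zero]

/-- The total number of nonzero roots in `I` of the integral polynomials of degree at most `n` and
height at most `B`. -/
def latticeCount (n B : ℕ) (I : Set ℝ) : ℝ :=
  ∑ k ∈ latticeBox (n + 1) B, (rootCount I (ofFn (n + 1) (intVec k)) : ℝ)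

theorem latticeCount_zero (n : ℕ) (I : Set ℝ) : latticeCount n 0 I = 0 := by
  refine Finset.sum_eq_zero fun k hk => ?_
  have hk0 : intVec k = 0 := funext fun i => by
    simpa [intVec] using mem_latticeBox.1 hk i
  rw [hk0, map_zero, rootCount_zero, Nat.cast_zero]

theorem sum_cubeCount_eq_latticeCount (hQ : 0 ≤ Q) (I : Set ℝ) :
    ∑ k ∈ latticeBox (n + 1) ⌈Q⌉₊, cubeCount Q I (intVec k) = latticeCount n ⌊Q⌋₊ I := by
  rw [latticeCount, ← Finset.sum_subset (latticeBox_mono (Nat.floor_le_ceil Q))]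
  · exact Finset.sum_congr rfl fun k hk =>
      Set.indicator_of_mem ((intVec_mem_cube_iff hQ).2 hk) _
  · exact fun k _ hk => Set.indicator_of_notMem (fun h => hk ((intVec_mem_cube_iff hQ).1 h)) _

theorem abs_latticeCount_sub_le (hn : 1 ≤ n) (hQ : 0 < Q) (hI : I.OrdConnected) :
    |latticeCount n ⌊Q⌋₊ I - Q ^ (n + 1) * ∫ t in I, density n t| ≤
      (n + 1) * (2 * (2 * n + 3 : ℕ) * (2 * ⌈Q⌉₊ + 1) ^ n) := by
  have integrable_integral : Integrable fun q : Fin n → ℝ => ∫ x, cubeCount Q I (Fin.cons x q) := by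
    simpa only [integral_cubeCount_cons hI] using
      (integrable_kernel_prod hn hQ I).integral_prod_left
  rw [← sum_cubeCount_eq_latticeCount hQ.le, ← integral_setIntegral_kernel hn hQ I]
  simp only [← integral_cubeCount_cons hI]
  exact (isLinewiseIntervalSum_rootCount hI).indicator_cube.abs_sum_sub_integral_le
    (fun v hv => Set.mem_of_indicator_ne_zero hv) integrable_integral

theorem setIntegral_density_nonneg (n : ℕ) (I : Set ℝ) : 0 ≤ ∫ t in I, density n t :=
  integral_nonneg fun t => density_nonneg t

theorem setIntegral_density_le (hn : 1 ≤ n) (I : Set ℝ) :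
    ∫ t in I, density n t ≤ ∫ t, density n t :=
  setIntegral_le_integral (integrable_density hn) (ae_of_all _ fun t => density_nonneg t)

theorem exists_abs_latticeCount_sub_le (hn : 1 ≤ n) :
    ∃ C : ℝ, ∀ I : Set ℝ, I.OrdConnected → ∀ Q : ℝ, 0 < Q →
      |latticeCount n ⌊Q⌋₊ I - Q ^ (n + 1) * ∫ t in I, density n t| ≤ C * Q ^ n := by
  refine ⟨max ((n + 1) * (2 * (2 * n + 3 : ℕ) * 5 ^ n)) (∫ t, density n t), fun I hI Q hQ => ?_⟩
  rcases lt_or_ge Q 1 with hQ1 | hQ1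
  · rw [Nat.floor_eq_zero.2 hQ1, latticeCount_zero, zero_sub, abs_neg,
      abs_of_nonneg (mul_nonneg (by positivity) (setIntegral_density_nonneg n I)), mul_comm]
    gcongr ?_ * ?_
    · exact (setIntegral_density_le hn I).trans (le_max_right _ _)
    · exact pow_le_pow_of_le_one hQ.le hQ1.le n.le_succ
  · have ceil_le : (⌈Q⌉₊ : ℝ) ≤ Q + 1 := (Nat.ceil_lt_add_one hQ.le).le
    calc _ ≤ (n + 1) * (2 * (2 * n + 3 : ℕ) * (2 * (⌈Q⌉₊ : ℝ) + 1) ^ n) :=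
          abs_latticeCount_sub_le hn hQ hI
      _ ≤ (n + 1) * (2 * (2 * n + 3 : ℕ) * (5 * Q) ^ n) := by gcongr; linarith
      _ = (n + 1) * (2 * (2 * n + 3 : ℕ) * 5 ^ n) * Q ^ n := by rw [mul_pow]; ring
      _ ≤ _ := by gcongr; exact le_max_left _ _

end KacRice

/-! ### Primitive polynomials -/

section Primitive

open scoped ArithmeticFunction.Moebius

variable {n m B : ℕ}

theorem LSeries_term_moebius (n d : ℕ) :
    LSeries.term (fun d => (μ d : ℂ)) ((n : ℂ) + 1) d =
      (((μ d : ℝ) / (d : ℝ) ^ (n + 1) : ℝ) : ℂ) := by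
  rw [LSeries.term_def]
  split_ifs with hd
  · simp [hd]
  · rw [← Nat.cast_add_one, Complex.cpow_natCast]
    push_cast
    rfl

theorem one_lt_re_natCast_add_one (hn : 1 ≤ n) : 1 < ((n : ℂ) + 1).re := by
  simpa using Nat.one_le_iff_ne_zero.1 hn |> Nat.pos_of_ne_zero

theorem summable_moebius_div_pow (hn : 1 ≤ n) :
    Summable fun d : ℕ => (μ d : ℝ) / (d : ℝ) ^ (n + 1) := by
  have hsum := ArithmeticFunction.LSeriesSummable_moebius_iff.2 (one_lt_re_natCast_add_one hn)
  rwa [LSeriesSummable, funext (LSeries_term_moebius n), Complex.summable_ofReal] at hsum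

theorem zeta_re_mul_tsum_moebius (hn : 1 ≤ n) :
    (riemannZeta ((n : ℂ) + 1)).re * ∑' d : ℕ, (μ d : ℝ) / (d : ℝ) ^ (n + 1) = 1 := by
  have hs := one_lt_re_natCast_add_one hn
  have hmul := ArithmeticFunction.LSeries_zeta_mul_Lseries_moebius hs
  rw [ArithmeticFunction.LSeries_zeta_eq_riemannZeta hs, LSeries,
    funext (LSeries_term_moebius n), ← Complex.ofReal_tsum] at hmul
  simpa using congrArg Complex.re hmul

theorem zeta_re_ne_zero (hn : 1 ≤ n) : (riemannZeta ((n : ℂ) + 1)).re ≠ 0 :=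
  left_ne_zero_of_mul_eq_one (zeta_re_mul_tsum_moebius hn)

theorem hasSum_moebius_div_pow (hn : 1 ≤ n) :
    HasSum (fun d : ℕ => (μ d : ℝ) / (d : ℝ) ^ (n + 1)) (1 / (riemannZeta ((n : ℂ) + 1)).re) := by
  convert (summable_moebius_div_pow hn).hasSum using 1
  rw [div_eq_iff (zeta_re_ne_zero hn), mul_comm, zeta_re_mul_tsum_moebius hn]

theorem sum_divisors_moebius (c : ℕ) :
    ∑ d ∈ c.divisors, (μ d : ℝ) = if c = 1 then 1 else 0 := by
  have h := congrArg (fun f : ArithmeticFunction ℝ => f c)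
    ArithmeticFunction.coe_moebius_mul_coe_zeta
  simpa only [ArithmeticFunction.coe_mul_zeta_apply, ArithmeticFunction.intCoe_apply,
    ArithmeticFunction.one_apply] using h

theorem dvd_content_ofFn {k : Fin m → ℤ} {d : ℤ} : d ∣ (ofFn m k).content ↔ ∀ i, d ∣ k i := by
  rw [dvd_content_iff_C_dvd, C_dvd_iff_dvd_coeff]
  refine ⟨fun h i => by simpa using h i, fun h i => ?_⟩
  rcases lt_or_ge i m with hi | hi
  · rw [ofFn_coeff_eq_val_of_lt k hi]
    exact h ⟨i, hi⟩
  · rw [ofFn_coeff_eq_zero_of_ge k hi]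
    exact dvd_zero d

theorem isPrimitive_iff_natAbs_content {p : ℤ[X]} : p.IsPrimitive ↔ p.content.natAbs = 1 := by
  have content_nonneg : 0 ≤ p.content := Int.nonneg_of_normalize_eq_self normalize_content
  rw [isPrimitive_iff_content_eq_one]
  omega

open Classical in
theorem filter_dvd_eq_divisors_content {k : Fin m → ℤ} (hk : k ∈ latticeBox m B) (hk0 : k ≠ 0) :
    (Finset.Icc 1 B).filter (fun d : ℕ => ∀ i, (d : ℤ) ∣ k i) =
      (ofFn m k).content.natAbs.divisors := by
  have content_ne_zero : (ofFn m k).content ≠ 0 := by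
    rw [Ne, content_eq_zero_iff, ← map_zero (ofFn m)]
    exact fun h => hk0 (injective_ofFn m h)
  obtain ⟨i, hi⟩ := Function.ne_iff.1 hk0
  ext d
  rw [Finset.mem_filter, Finset.mem_Icc, Nat.mem_divisors, ← dvd_content_ofFn, ← Int.natCast_dvd]
  refine ⟨fun ⟨_, h⟩ => ⟨h, Int.natAbs_ne_zero.2 content_ne_zero⟩, fun ⟨h, _⟩ => ⟨⟨?_, ?_⟩, h⟩⟩
  · refine Nat.one_le_iff_ne_zero.2 fun hd => content_ne_zero ?_
    simpa [hd] using h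
  · have d_le : (d : ℤ) ≤ |k i| :=
      Int.le_of_dvd (abs_pos.2 hi) ((dvd_abs _ _).2 (dvd_content_ofFn.1 h i))
    exact_mod_cast d_le.trans (mem_latticeBox.1 hk i)

theorem sum_dvd_latticeBox {d : ℕ} (hd : 0 < d) (f : (Fin m → ℤ) → ℝ)
    (hf : ∀ k, f ((d : ℤ) • k) = f k) :
    ∑ k ∈ latticeBox m B with ∀ i, (d : ℤ) ∣ k i, f k = ∑ k ∈ latticeBox m (B / d), f k := by
  have hd' : (0 : ℤ) < d := by exact_mod_cast hd
  have smul_mem : ∀ k : Fin m → ℤ, (d : ℤ) • k ∈ latticeBox m B ↔ k ∈ latticeBox m (B / d) := by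
    intro k
    simp only [mem_latticeBox, Pi.smul_apply, smul_eq_mul, abs_mul, abs_of_pos hd',
      Int.natCast_div, Int.le_ediv_iff_mul_le hd', mul_comm]
  symm
  refine Finset.sum_bij (fun k _ => (d : ℤ) • k) ?_ ?_ ?_ fun k _ => (hf k).symm
  · exact fun k hk => Finset.mem_filter.2 ⟨(smul_mem k).2 hk, fun i => ⟨k i, rfl⟩⟩
  · exact fun k _ l _ h => smul_right_injective _ hd'.ne' h
  · intro k hk
    obtain ⟨hkB, hdvd⟩ := Finset.mem_filter.1 hk
    choose l hl using hdvd
    obtain rfl : k = (d : ℤ) • l := funext hl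
    exact ⟨l, (smul_mem l).1 hkB, rfl⟩

open Classical in
theorem sum_primitive_eq_sum_moebius (f : (Fin m → ℤ) → ℝ)
    (hf : ∀ (d : ℕ) (k : Fin m → ℤ), 0 < d → f ((d : ℤ) • k) = f k) (hf0 : f 0 = 0) :
    ∑ k ∈ latticeBox m B with (ofFn m k).IsPrimitive, f k =
      ∑ d ∈ Finset.Icc 1 B, (μ d : ℝ) * ∑ k ∈ latticeBox m (B / d), f k := by
  have primitive_eq : ∀ k ∈ latticeBox m B, (if (ofFn m k).IsPrimitive then f k else 0) =
      ∑ d ∈ Finset.Icc 1 B, (μ d : ℝ) * if ∀ i, (d : ℤ) ∣ k i then f k else 0 := by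
    intro k hk
    obtain rfl | hk0 := eq_or_ne k 0
    · simp [hf0]
    simp only [mul_ite, mul_zero]
    rw [← Finset.sum_filter, filter_dvd_eq_divisors_content hk hk0, ← Finset.sum_mul,
      sum_divisors_moebius]
    simp only [isPrimitive_iff_natAbs_content, ite_mul, one_mul, zero_mul]
  rw [Finset.sum_filter, Finset.sum_congr rfl primitive_eq, Finset.sum_comm]
  refine Finset.sum_congr rfl fun d hd => ?_
  have d_pos : 0 < d := (Finset.mem_Icc.1 hd).1
  rw [← Finset.mul_sum, ← Finset.sum_filter, sum_dvd_latticeBox d_pos f fun k => hf d k d_pos]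

open Classical in
/-- The total number of nonzero roots in `I` of the primitive integral polynomials of degree at most
`n` and height at most `B`. -/
def primitiveCount (n B : ℕ) (I : Set ℝ) : ℝ :=
  ∑ k ∈ latticeBox (n + 1) B with (ofFn (n + 1) k).IsPrimitive,
    (rootCount I (ofFn (n + 1) (intVec k)) : ℝ)

theorem intVec_smul (d : ℤ) (k : Fin m → ℤ) : intVec (d • k) = (d : ℝ) • intVec k := by
  ext i
  simp [intVec]

theorem primitiveCount_eq_sum_moebius (n B : ℕ) (I : Set ℝ) :
    primitiveCount n B I = ∑ d ∈ Finset.Icc 1 B, (μ d : ℝ) * latticeCount n (B / d) I := by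
  refine sum_primitive_eq_sum_moebius (fun k => (rootCount I (ofFn (n + 1) (intVec k)) : ℝ))
    (fun d k hd => ?_) ?_
  · rw [intVec_smul, map_smul, rootCount_smul]
    exact_mod_cast hd.ne'
  · have intVec_zero : intVec (0 : Fin (n + 1) → ℤ) = 0 := by simpa using intVec_smul 0 0
    rw [intVec_zero, map_zero, rootCount_zero, Nat.cast_zero]

theorem hasSum_moebius_mul_latticeCount (n B : ℕ) (I : Set ℝ) :
    HasSum (fun d : ℕ => (μ d : ℝ) * latticeCount n (B / d) I) (primitiveCount n B I) := by
  rw [primitiveCount_eq_sum_moebius]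
  refine hasSum_sum_of_ne_finset_zero fun d hd => ?_
  obtain rfl | hd0 := Nat.eq_zero_or_pos d
  · simp
  · have hdB : B < d := by simpa [Nat.succ_le_of_lt hd0] using hd
    rw [Nat.div_eq_of_lt hdB, latticeCount_zero, mul_zero]

theorem norm_moebius_mul_sub_le (hn : n ≠ 0) {Q C V : ℝ} {I : Set ℝ} (hQ : 0 < Q)
    (hC : ∀ Q : ℝ, 0 < Q → |latticeCount n ⌊Q⌋₊ I - Q ^ (n + 1) * V| ≤ C * Q ^ n) (d : ℕ) :
    ‖(μ d : ℝ) * latticeCount n (⌊Q⌋₊ / d) I - (μ d : ℝ) / (d : ℝ) ^ (n + 1) * (Q ^ (n + 1) * V)‖ ≤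
      C * Q ^ n * (1 / (d : ℝ) ^ n) := by
  obtain rfl | hd := Nat.eq_zero_or_pos d
  · simp [hn]
  have hd' : (0 : ℝ) < d := by exact_mod_cast hd
  have abs_moebius_le : |(μ d : ℝ)| ≤ 1 := by
    exact_mod_cast ArithmeticFunction.abs_moebius_le_one
  have main_le := hC (Q / d) (div_pos hQ hd')
  rw [Nat.floor_div_natCast] at main_le
  calc ‖(μ d : ℝ) * latticeCount n (⌊Q⌋₊ / d) I - (μ d : ℝ) / (d : ℝ) ^ (n + 1) * (Q ^ (n + 1) * V)‖
      = |(μ d : ℝ)| * |latticeCount n (⌊Q⌋₊ / d) I - (Q / d) ^ (n + 1) * V| := by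
        rw [Real.norm_eq_abs, ← abs_mul, div_pow]
        ring_nf
    _ ≤ 1 * (C * (Q / d) ^ n) := mul_le_mul abs_moebius_le main_le (abs_nonneg _) zero_le_one
    _ = _ := by rw [div_pow]; ring

theorem exists_abs_primitiveCount_sub_le (hn : 2 ≤ n) :
    ∃ C : ℝ, ∀ I : Set ℝ, I.OrdConnected → ∀ Q : ℝ, 0 < Q →
      |primitiveCount n ⌊Q⌋₊ I -
        Q ^ (n + 1) / (riemannZeta ((n : ℂ) + 1)).re * ∫ t in I, density n t| ≤ C * Q ^ n := by
  have one_le : 1 ≤ n := one_le_two.trans hn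
  obtain ⟨C, hC⟩ := exists_abs_latticeCount_sub_le one_le
  have summable_inv_pow : Summable fun d : ℕ => 1 / (d : ℝ) ^ n :=
    Real.summable_one_div_nat_pow.2 hn
  refine ⟨C * ∑' d : ℕ, 1 / (d : ℝ) ^ n, fun I hI Q hQ => ?_⟩
  have hasSum_error := (hasSum_moebius_mul_latticeCount n ⌊Q⌋₊ I).sub
    ((hasSum_moebius_div_pow one_le).mul_right (Q ^ (n + 1) * ∫ t in I, density n t))
  have error_le := tsum_of_norm_bounded (summable_inv_pow.hasSum.mul_left (C * Q ^ n))
    (norm_moebius_mul_sub_le (Nat.one_le_iff_ne_zero.1 one_le) hQ (hC I hI))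
  rw [hasSum_error.tsum_eq, Real.norm_eq_abs] at error_le
  convert error_le using 1
  · congr 2
    ring
  · ring

end Primitive

/-! ### Irreducible polynomials -/

section Irreducible

variable {n m B : ℕ} {p q : ℤ[X]} {α : ℝ}

theorem isUnit_of_isPrimitive_of_dvd (hp : p.IsPrimitive) (hq : q ∣ p) (hdeg : q.natDegree = 0) :
    IsUnit q := by
  rw [eq_C_of_natDegree_eq_zero hdeg] at hq ⊢
  exact isUnit_C.2 (hp _ hq)

theorem IsMinimalPolynomial.irreducible (hp : IsMinimalPolynomial p α) : Irreducible p := by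
  obtain ⟨hp0, hα, natDegree_le, primitive⟩ := hp
  refine ⟨fun hunit => hp0 ?_, fun a b hab => ?_⟩
  · have p_eq := eq_C_of_natDegree_eq_zero (natDegree_eq_zero_of_isUnit hunit)
    rw [p_eq, aeval_C] at hα
    rw [p_eq, (algebraMap ℤ ℝ).injective_int (hα.trans (map_zero _).symm), map_zero]
  · have ha0 : a ≠ 0 := left_ne_zero_of_mul (hab ▸ hp0)
    have hb0 : b ≠ 0 := right_ne_zero_of_mul (hab ▸ hp0)
    have natDegree_eq : p.natDegree = a.natDegree + b.natDegree := by
      rw [hab, natDegree_mul ha0 hb0]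
    rw [hab, map_mul] at hα
    rcases mul_eq_zero.1 hα with haα | hbα
    · have := natDegree_le a ha0 haα
      exact Or.inr (isUnit_of_isPrimitive_of_dvd primitive (Dvd.intro_left a hab.symm) (by omega))
    · have := natDegree_le b hb0 hbα
      exact Or.inl (isUnit_of_isPrimitive_of_dvd primitive (Dvd.intro b hab.symm) (by omega))

theorem dvd_of_irreducible_of_common_root (hp : Irreducible p) (hdeg : p.natDegree ≠ 0)
    (hpα : aeval α p = 0) (hqα : aeval α q = 0) : p ∣ q := by
  have primitive := hp.isPrimitive hdeg
  have irreducible_map := (IsPrimitive.Int.irreducible_iff_irreducible_map_cast primitive).1 hp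
  have minpoly_eq := minpoly.eq_of_irreducible irreducible_map
    ((aeval_map_algebraMap ℚ α p).trans hpα)
  have minpoly_dvd := minpoly.dvd ℚ α ((aeval_map_algebraMap ℚ α q).trans hqα)
  exact (IsPrimitive.Int.dvd_iff_map_cast_dvd_map_cast p q primitive).2
    ((Dvd.intro _ minpoly_eq).trans minpoly_dvd)

theorem isMinimalPolynomial_of_irreducible (hp : Irreducible p) (hdeg : p.natDegree ≠ 0)
    (hα : aeval α p = 0) : IsMinimalPolynomial p α :=
  ⟨hp.ne_zero, hα, fun _ hq hqα =>
    natDegree_le_of_dvd (dvd_of_irreducible_of_common_root hp hdeg hα hqα) hq, hp.isPrimitive hdeg⟩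

theorem eq_or_eq_neg_of_common_root (hp : Irreducible p) (hq : Irreducible q)
    (hdeg : p.natDegree ≠ 0) (hpα : aeval α p = 0) (hqα : aeval α q = 0) : q = p ∨ q = -p := by
  obtain ⟨u, hu⟩ := hp.associated_of_dvd hq (dvd_of_irreducible_of_common_root hp hdeg hpα hqα)
  obtain ⟨r, hr, hru⟩ := Polynomial.isUnit_iff.1 u.isUnit
  rw [← hu, ← hru]
  rcases Int.isUnit_iff.1 hr with rfl | rfl <;> simp

theorem IsMinimalPolynomial.ne_zero (hp : IsMinimalPolynomial p α) (hdeg : 2 ≤ p.natDegree) :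
    α ≠ 0 := by
  rintro rfl
  have natDegree_le := hp.2.2.1 X X_ne_zero (aeval_X 0)
  rw [natDegree_X] at natDegree_le
  omega

theorem height_le_iff : height p ≤ B ↔ ∀ i, |p.coeff i| ≤ B := by
  simp only [height, Finset.sup_le_iff, Int.abs_eq_natAbs, Nat.cast_le]
  refine ⟨fun h i => ?_, fun h i _ => h i⟩
  by_cases hi : i ∈ p.support
  · exact h i hi
  · simp [notMem_support_iff.1 hi]

theorem height_neg (p : ℤ[X]) : height (-p) = height p := by simp [height]

theorem mem_latticeBox_iff_height_le {k : Fin m → ℤ} :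
    k ∈ latticeBox m B ↔ height (ofFn m k) ≤ B := by
  rw [mem_latticeBox, height_le_iff]
  refine ⟨fun h i => ?_, fun h i => by simpa using h i⟩
  rcases lt_or_ge i m with hi | hi
  · rw [ofFn_coeff_eq_val_of_lt k hi]
    exact h ⟨i, hi⟩
  · simp [ofFn_coeff_eq_zero_of_ge k hi]

theorem map_ofFn_eq_ofFn_intVec (k : Fin m → ℤ) :
    (ofFn m k).map (algebraMap ℤ ℝ) = ofFn m (intVec k) := by
  ext i
  rcases lt_or_ge i m with hi | hi
  · rw [coeff_map, ofFn_coeff_eq_val_of_lt _ hi, ofFn_coeff_eq_val_of_lt _ hi]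
    rfl
  · rw [coeff_map, ofFn_coeff_eq_zero_of_ge _ hi, ofFn_coeff_eq_zero_of_ge _ hi, map_zero]

open Classical in
/-- The coefficient vectors of the irreducible integral polynomials of degree `n` and height at
most `B`. -/
def irreducibleBox (n B : ℕ) : Finset (Fin (n + 1) → ℤ) :=
  (latticeBox (n + 1) B).filter fun k =>
    Irreducible (ofFn (n + 1) k) ∧ (ofFn (n + 1) k).natDegree = n

theorem mem_irreducibleBox {k : Fin (n + 1) → ℤ} :
    k ∈ irreducibleBox n B ↔ height (ofFn (n + 1) k) ≤ B ∧
      Irreducible (ofFn (n + 1) k) ∧ (ofFn (n + 1) k).natDegree = n := by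
  classical
  rw [irreducibleBox, Finset.mem_filter, mem_latticeBox_iff_height_le]

open Classical in
theorem rootCount_eq_card_filter_algebraicNumbers (hn : 2 ≤ n) {Q : ℝ} (hQ : 0 ≤ Q) (I : Set ℝ)
    {k : Fin (n + 1) → ℤ} (hk : k ∈ irreducibleBox n ⌊Q⌋₊) :
    rootCount I (ofFn (n + 1) (intVec k)) =
      (((finite_algebraicNumbers n Q).inter_of_left I).toFinset.filter
        fun α => aeval α (ofFn (n + 1) k) = 0).card := by
  obtain ⟨height_le, irreducible, natDegree_eq⟩ := mem_irreducibleBox.1 hk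
  have natDegree_ne : (ofFn (n + 1) k).natDegree ≠ 0 := by omega
  have map_ne_zero : (ofFn (n + 1) k).map (algebraMap ℤ ℝ) ≠ 0 :=
    (Polynomial.map_ne_zero_iff (algebraMap ℤ ℝ).injective_int).2 irreducible.ne_zero
  rw [rootCount, ← map_ofFn_eq_ofFn_intVec]
  congr 1
  ext α
  rw [Finset.mem_filter, Finset.mem_filter, Multiset.mem_toFinset, mem_roots map_ne_zero,
    IsRoot.def, eval_map_algebraMap, Set.Finite.mem_toFinset, Set.mem_inter_iff]
  constructor
  · rintro ⟨hα, hαI, -⟩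
    exact ⟨⟨⟨_, isMinimalPolynomial_of_irreducible irreducible natDegree_ne hα, natDegree_eq,
      (Nat.le_floor_iff hQ).1 height_le⟩, hαI⟩, hα⟩
  · rintro ⟨⟨-, hαI⟩, hα⟩
    have minimal := isMinimalPolynomial_of_irreducible irreducible natDegree_ne hα
    exact ⟨hα, hαI, minimal.ne_zero (hn.trans_eq natDegree_eq.symm)⟩

open Classical in
theorem card_filter_irreducibleBox_root (hn : n ≠ 0) {Q : ℝ} (hα : α ∈ algebraicNumbers n Q) :
    ((irreducibleBox n ⌊Q⌋₊).filter fun k => aeval α (ofFn (n + 1) k) = 0).card = 2 := by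
  obtain ⟨p, hp, natDegree_eq, height_le⟩ := hα
  obtain ⟨k₀, rfl⟩ : ∃ k₀, ofFn (n + 1) k₀ = p :=
    ⟨toFn (n + 1) p, ofFn_comp_toFn_eq_id_of_natDegree_lt (Nat.lt_succ_of_le natDegree_eq.le)⟩
  have neg_irreducible : Irreducible (-ofFn (n + 1) k₀) :=
    (Associated.refl (ofFn (n + 1) k₀)).neg_right.irreducible hp.irreducible
  have filter_eq : (irreducibleBox n ⌊Q⌋₊).filter (fun k => aeval α (ofFn (n + 1) k) = 0) =
      {k₀, -k₀} := by
    ext k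
    rw [Finset.mem_filter, mem_irreducibleBox, Finset.mem_insert, Finset.mem_singleton]
    constructor
    · rintro ⟨⟨-, hk, -⟩, hkα⟩
      refine (eq_or_eq_neg_of_common_root hp.irreducible hk (natDegree_eq.trans_ne hn) hp.2.1
        hkα).imp (fun h => injective_ofFn _ h) fun h => injective_ofFn _ ?_
      rw [h, map_neg]
    · rintro (rfl | rfl)
      · exact ⟨⟨Nat.le_floor height_le, hp.irreducible, natDegree_eq⟩, hp.2.1⟩
      · rw [map_neg, height_neg, natDegree_neg, map_neg, hp.2.1, neg_zero]
        exact ⟨⟨Nat.le_floor height_le, neg_irreducible, natDegree_eq⟩, rfl⟩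
  have k₀_ne_zero : k₀ ≠ 0 := fun h => hp.1 (by rw [h, map_zero])
  rw [filter_eq, Finset.card_pair (self_ne_neg.2 k₀_ne_zero)]

theorem two_mul_count (hn : 2 ≤ n) {Q : ℝ} (hQ : 0 ≤ Q) (I : Set ℝ) :
    2 * count n Q I =
      ∑ k ∈ irreducibleBox n ⌊Q⌋₊, rootCount I (ofFn (n + 1) (intVec k)) := by
  classical
  have hfin : (algebraicNumbers n Q ∩ I).Finite := (finite_algebraicNumbers n Q).inter_of_left I
  calc 2 * count n Q I = ∑ α ∈ hfin.toFinset,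
        ((irreducibleBox n ⌊Q⌋₊).filter fun k => aeval α (ofFn (n + 1) k) = 0).card := by
        rw [Finset.sum_const_nat fun α hα => card_filter_irreducibleBox_root (by omega)
          ((Set.Finite.mem_toFinset _).1 hα).1, count, Set.ncard_eq_toFinset_card _ hfin, mul_comm]
    _ = ∑ k ∈ irreducibleBox n ⌊Q⌋₊,
        (hfin.toFinset.filter fun α => aeval α (ofFn (n + 1) k) = 0).card :=
        (Finset.sum_card_bipartiteAbove_eq_sum_card_bipartiteBelow _).symm
    _ = _ := Finset.sum_congr rfl fun k hk =>
        (rootCount_eq_card_filter_algebraicNumbers hn hQ I hk).symm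

open Classical in
/-- The coefficient vectors of the integral polynomials of degree `n` and height at most `B` that
are products of two polynomials of positive degree. -/
def reducibleBox (n B : ℕ) : Finset (Fin (n + 1) → ℤ) :=
  (latticeBox (n + 1) B).filter fun k => (ofFn (n + 1) k).natDegree = n ∧
    ∃ a b : ℤ[X], ofFn (n + 1) k = a * b ∧ 1 ≤ a.natDegree ∧ 1 ≤ b.natDegree

theorem exists_mul_of_isPrimitive_of_not_irreducible (hprim : p.IsPrimitive)
    (hdeg : p.natDegree ≠ 0) (hirr : ¬ Irreducible p) :
    ∃ a b : ℤ[X], p = a * b ∧ 1 ≤ a.natDegree ∧ 1 ≤ b.natDegree := by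
  rw [irreducible_iff] at hirr
  push Not at hirr
  obtain ⟨a, b, hab, ha, hb⟩ := hirr (mt natDegree_eq_zero_of_isUnit hdeg)
  refine ⟨a, b, hab, Nat.one_le_iff_ne_zero.2 fun h => ha ?_,
    Nat.one_le_iff_ne_zero.2 fun h => hb ?_⟩
  · exact isUnit_of_isPrimitive_of_dvd hprim (Dvd.intro b hab.symm) h
  · exact isUnit_of_isPrimitive_of_dvd hprim (Dvd.intro_left a hab.symm) h

theorem last_eq_zero_or_mem_reducibleBox (hn : n ≠ 0) {k : Fin (n + 1) → ℤ}
    (hk : k ∈ latticeBox (n + 1) B) (hprim : (ofFn (n + 1) k).IsPrimitive)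
    (hirr : k ∉ irreducibleBox n B) : k (Fin.last n) = 0 ∨ k ∈ reducibleBox n B := by
  classical
  refine or_iff_not_imp_left.2 fun last_ne_zero => ?_
  have natDegree_eq : (ofFn (n + 1) k).natDegree = n := by
    refine (natDegree_ofFn_le k).antisymm (le_natDegree_of_ne_zero ?_)
    rwa [ofFn_coeff_eq_val_of_lt k n.lt_succ_self]
  rw [reducibleBox, Finset.mem_filter]
  refine ⟨hk, natDegree_eq, exists_mul_of_isPrimitive_of_not_irreducible hprim
    (natDegree_eq.trans_ne hn) fun h => hirr ?_⟩
  exact mem_irreducibleBox.2 ⟨mem_latticeBox_iff_height_le.1 hk, h, natDegree_eq⟩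

theorem card_filter_last_eq_zero (n B : ℕ) :
    ((latticeBox (n + 1) B).filter fun k => k (Fin.last n) = 0).card = (2 * B + 1) ^ n := by
  rw [Finset.card_filter, sum_latticeBox_succ (Fin.last n)]
  simp [Finset.sum_ite_eq', card_latticeBox]

theorem abs_primitiveCount_sub_two_mul_count_le (hn : 2 ≤ n) {Q : ℝ} (hQ : 0 ≤ Q) (I : Set ℝ) :
    |primitiveCount n ⌊Q⌋₊ I - 2 * count n Q I| ≤
      n * ((2 * ⌊Q⌋₊ + 1) ^ n + (reducibleBox n ⌊Q⌋₊).card) := by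
  classical
  set B := ⌊Q⌋₊
  set P := (latticeBox (n + 1) B).filter fun k => (ofFn (n + 1) k).IsPrimitive
  have subset : irreducibleBox n B ⊆ P := fun k hk => by
    rw [irreducibleBox, Finset.mem_filter] at hk
    exact Finset.mem_filter.2 ⟨hk.1, hk.2.1.isPrimitive (by omega)⟩
  have two_mul_count_eq : (2 : ℝ) * count n Q I =
      ∑ k ∈ irreducibleBox n B, (rootCount I (ofFn (n + 1) (intVec k)) : ℝ) := by
    exact_mod_cast two_mul_count hn hQ I
  have card_le : (P \ irreducibleBox n B).card ≤ (2 * B + 1) ^ n + (reducibleBox n B).card := by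
    rw [← card_filter_last_eq_zero n B]
    refine (Finset.card_le_card fun k hk => ?_).trans (Finset.card_union_le _ _)
    obtain ⟨hkP, hirr⟩ := Finset.mem_sdiff.1 hk
    obtain ⟨hkB, hprim⟩ := Finset.mem_filter.1 hkP
    exact Finset.mem_union.2 ((last_eq_zero_or_mem_reducibleBox (by omega) hkB hprim hirr).imp_left
      fun h => Finset.mem_filter.2 ⟨hkB, h⟩)
  rw [primitiveCount, two_mul_count_eq, ← Finset.sum_sdiff subset, add_sub_cancel_right,
    abs_of_nonneg (Finset.sum_nonneg fun _ _ => Nat.cast_nonneg _)]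
  calc ∑ k ∈ P \ irreducibleBox n B, (rootCount I (ofFn (n + 1) (intVec k)) : ℝ)
      ≤ (P \ irreducibleBox n B).card • (n : ℝ) := Finset.sum_le_card_nsmul _ _ _ fun k _ => by
        exact_mod_cast (rootCount_le_natDegree I _).trans (natDegree_ofFn_le _)
    _ ≤ n * ((2 * B + 1) ^ n + (reducibleBox n B).card) := by
        rw [nsmul_eq_mul, mul_comm]
        gcongr
        exact_mod_cast card_le

end Irreducible

/-! ### Reducible polynomials -/

section Reducible

variable {n m B : ℕ} {p a b : ℤ[X]}

theorem natAbs_coeff_le_height (p : ℤ[X]) (i : ℕ) : (p.coeff i).natAbs ≤ height p := by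
  exact_mod_cast Int.abs_eq_natAbs _ ▸ height_le_iff.1 le_rfl i

theorem one_le_height (hp : p ≠ 0) : 1 ≤ height p :=
  (Int.natAbs_pos.2 (leadingCoeff_ne_zero.2 hp)).trans_le (natAbs_coeff_le_height p p.natDegree)

theorem norm_coeff_map_intCast (p : ℤ[X]) (i : ℕ) :
    ‖(p.map (Int.castRingHom ℂ)).coeff i‖ = (p.coeff i).natAbs := by
  rw [coeff_map, eq_intCast, Complex.norm_intCast, Nat.cast_natAbs, Int.cast_abs]

theorem natDegree_map_intCast (p : ℤ[X]) : (p.map (Int.castRingHom ℂ)).natDegree = p.natDegree :=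
  natDegree_map_eq_of_injective (RingHom.injective_int _) p

theorem height_le_two_pow_mul_mahlerMeasure (p : ℤ[X]) :
    (height p : ℝ) ≤ 2 ^ p.natDegree * (p.map (Int.castRingHom ℂ)).mahlerMeasure := by
  have mahlerMeasure_nonneg' := mahlerMeasure_nonneg (p.map (Int.castRingHom ℂ))
  rw [← Nat.le_floor_iff (by positivity), height, Finset.sup_le_iff]
  refine fun i _ => Nat.le_floor ?_
  rw [← norm_coeff_map_intCast]
  refine (norm_coeff_le_choose_mul_mahlerMeasure i _).trans ?_
  rw [natDegree_map_intCast]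
  gcongr
  exact_mod_cast Nat.choose_le_two_pow _ _

theorem mahlerMeasure_le_mul_height (p : ℤ[X]) :
    (p.map (Int.castRingHom ℂ)).mahlerMeasure ≤ (p.natDegree + 1) * height p := by
  refine (mahlerMeasure_le_sum_norm_coeff _).trans ?_
  rw [Polynomial.sum_over_range _ fun _ => norm_zero, natDegree_map_intCast]
  refine (Finset.sum_le_card_nsmul _ _ (height p : ℝ) fun i _ => ?_).trans_eq ?_
  · rw [norm_coeff_map_intCast]
    exact_mod_cast natAbs_coeff_le_height p i
  · rw [Finset.card_range, nsmul_eq_mul, Nat.cast_add_one]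

theorem height_mul_height_le (ha : a ≠ 0) (hb : b ≠ 0) :
    height a * height b ≤
      2 ^ (a * b).natDegree * ((a * b).natDegree + 1) * height (a * b) := by
  have mahlerMeasure_nonneg' := mahlerMeasure_nonneg (a.map (Int.castRingHom ℂ))
  have real_le : (height a : ℝ) * height b ≤
      2 ^ (a * b).natDegree * ((a * b).natDegree + 1) * height (a * b) := by
    calc (height a : ℝ) * height b
        ≤ (2 ^ a.natDegree * (a.map (Int.castRingHom ℂ)).mahlerMeasure) *
            (2 ^ b.natDegree * (b.map (Int.castRingHom ℂ)).mahlerMeasure) :=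
          mul_le_mul (height_le_two_pow_mul_mahlerMeasure a)
            (height_le_two_pow_mul_mahlerMeasure b) (Nat.cast_nonneg _) (by positivity)
      _ = 2 ^ (a * b).natDegree * ((a * b).map (Int.castRingHom ℂ)).mahlerMeasure := by
          rw [mul_mul_mul_comm, ← pow_add, ← natDegree_mul ha hb, ← mahlerMeasure_mul,
            ← Polynomial.map_mul]
      _ ≤ 2 ^ (a * b).natDegree * (((a * b).natDegree + 1) * height (a * b)) :=
          mul_le_mul_of_nonneg_left (mahlerMeasure_le_mul_height _) (by positivity)
      _ = _ := (mul_assoc _ _ _).symm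
  exact_mod_cast real_le

/-- For `1 ≤ h`, the integer vectors of length `m` whose largest absolute entry is `h`. -/
def latticeSphere (m h : ℕ) : Finset (Fin m → ℤ) := latticeBox m h \ latticeBox m (h - 1)

theorem mem_latticeSphere_iff_height_eq {h : ℕ} (hh : 1 ≤ h) {k : Fin m → ℤ} :
    k ∈ latticeSphere m h ↔ height (ofFn m k) = h := by
  rw [latticeSphere, Finset.mem_sdiff, mem_latticeBox_iff_height_le, mem_latticeBox_iff_height_le]
  omega

theorem card_latticeSphere_le {h : ℕ} (hh : 1 ≤ h) :
    ((latticeSphere (m + 1) h).card : ℝ) ≤ 2 * (m + 1) * (3 * h) ^ m := by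
  have subset : latticeBox (m + 1) (h - 1) ⊆ latticeBox (m + 1) h := latticeBox_mono (h.sub_le 1)
  have one_le : (1 : ℝ) ≤ h := by exact_mod_cast hh
  have pow_sub_pow_le := abs_pow_sub_pow_le (2 * (h : ℝ) + 1) (2 * (h - 1) + 1) (m + 1)
  rw [show 2 * (h : ℝ) + 1 - (2 * (h - 1) + 1) = 2 by ring, abs_two,
    abs_of_nonneg (by linarith : (0 : ℝ) ≤ 2 * h + 1),
    abs_of_nonneg (by linarith : (0 : ℝ) ≤ 2 * (h - 1) + 1), max_eq_left (by linarith),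
    Nat.add_sub_cancel] at pow_sub_pow_le
  rw [latticeSphere, Finset.card_sdiff_of_subset subset, Nat.cast_sub (Finset.card_le_card subset),
    card_latticeBox, card_latticeBox]
  push_cast [Nat.cast_sub hh] at pow_sub_pow_le ⊢
  refine (le_abs_self _).trans (pow_sub_pow_le.trans ?_)
  gcongr
  linarith

theorem exists_mem_latticeSphere_of_mem_reducibleBox {k : Fin (n + 1) → ℤ}
    (hk : k ∈ reducibleBox n B) :
    ∃ d ∈ Finset.Icc 1 (n / 2), ∃ h ∈ Finset.Icc 1 (2 ^ n * (n + 1) * B),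
      ∃ u ∈ latticeSphere (d + 1) h, ∃ v ∈ latticeBox (n - d + 1) (2 ^ n * (n + 1) * B / h),
        ofFn (n + 1) k = ofFn (d + 1) u * ofFn (n - d + 1) v := by
  classical
  rw [reducibleBox, Finset.mem_filter, mem_latticeBox_iff_height_le] at hk
  obtain ⟨height_le, natDegree_eq, a, b, hab, ha, hb⟩ := hk
  wlog hle : a.natDegree ≤ b.natDegree generalizing a b
  · exact this b a (hab.trans (mul_comm a b)) hb ha (le_of_not_ge hle)
  have ha0 : a ≠ 0 := ne_zero_of_natDegree_gt ha
  have hb0 : b ≠ 0 := ne_zero_of_natDegree_gt hb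
  have natDegree_add : a.natDegree + b.natDegree = n := by
    rw [← natDegree_mul ha0 hb0, ← hab, natDegree_eq]
  have height_mul_le : height a * height b ≤ 2 ^ n * (n + 1) * B := by
    refine (height_mul_height_le ha0 hb0).trans ?_
    rw [← hab, natDegree_eq]
    exact Nat.mul_le_mul_left _ height_le
  have ofFn_toFn_a : ofFn (a.natDegree + 1) (toFn _ a) = a :=
    ofFn_comp_toFn_eq_id_of_natDegree_lt a.natDegree.lt_succ_self
  have ofFn_toFn_b : ofFn (n - a.natDegree + 1) (toFn _ b) = b :=
    ofFn_comp_toFn_eq_id_of_natDegree_lt (by omega)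
  refine ⟨a.natDegree, Finset.mem_Icc.2 ⟨ha, by omega⟩, height a, Finset.mem_Icc.2
    ⟨one_le_height ha0, (Nat.le_mul_of_pos_right _ (one_le_height hb0)).trans height_mul_le⟩,
    toFn _ a, ?_, toFn _ b, ?_, ?_⟩
  · rw [mem_latticeSphere_iff_height_eq (one_le_height ha0), ofFn_toFn_a]
  · rwa [mem_latticeBox_iff_height_le, ofFn_toFn_b, Nat.le_div_iff_mul_le (one_le_height ha0),
      mul_comm]
  · rw [ofFn_toFn_a, ofFn_toFn_b, hab]

theorem card_reducibleBox_le_sum (n B : ℕ) :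
    (reducibleBox n B).card ≤
      ∑ d ∈ Finset.Icc 1 (n / 2), ∑ h ∈ Finset.Icc 1 (2 ^ n * (n + 1) * B),
        (latticeSphere (d + 1) h).card *
          (latticeBox (n - d + 1) (2 ^ n * (n + 1) * B / h)).card := by
  classical
  have subset : reducibleBox n B ⊆ (Finset.Icc 1 (n / 2)).biUnion fun d =>
      (Finset.Icc 1 (2 ^ n * (n + 1) * B)).biUnion fun h =>
        (latticeSphere (d + 1) h ×ˢ latticeBox (n - d + 1) (2 ^ n * (n + 1) * B / h)).image
          fun x => toFn (n + 1) (ofFn (d + 1) x.1 * ofFn (n - d + 1) x.2) := by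
    intro k hk
    obtain ⟨d, hd, h, hh, u, hu, v, hv, hk_eq⟩ := exists_mem_latticeSphere_of_mem_reducibleBox hk
    simp only [Finset.mem_biUnion, Finset.mem_image, Finset.mem_product]
    exact ⟨d, hd, h, hh, (u, v), ⟨hu, hv⟩, by
      rw [← hk_eq, toFn_comp_ofFn_eq_id]⟩
  refine (Finset.card_le_card subset).trans (Finset.card_biUnion_le.trans ?_)
  refine Finset.sum_le_sum fun d _ => Finset.card_biUnion_le.trans ?_
  refine Finset.sum_le_sum fun h _ => Finset.card_image_le.trans_eq ?_
  rw [Finset.card_product]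

theorem card_latticeSphere_mul_card_latticeBox_le {d h X : ℕ} (hd : d ∈ Finset.Icc 1 (n / 2))
    (hh : h ∈ Finset.Icc 1 X) :
    ((latticeSphere (d + 1) h).card : ℝ) * (latticeBox (n - d + 1) (X / h)).card ≤
      2 * (n + 1) * 3 ^ (n + 1) * ((X : ℝ) ^ (n - d + 1) / (h : ℝ) ^ (n - d + 1 - d)) := by
  rw [Finset.mem_Icc] at hd hh
  have one_le_h : (1 : ℝ) ≤ h := by exact_mod_cast hh.1
  have h_le_X : (h : ℝ) ≤ X := by exact_mod_cast hh.2
  have one_le_div : (1 : ℝ) ≤ X / h := (one_le_div (by linarith)).2 h_le_X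
  have card_box_le : ((latticeBox (n - d + 1) (X / h)).card : ℝ) ≤ (3 * (X / h)) ^ (n - d + 1) := by
    rw [card_latticeBox]
    push_cast
    gcongr
    linarith [Nat.cast_div_le (α := ℝ) (m := X) (n := h)]
  have card_sphere_le : ((latticeSphere (d + 1) h).card : ℝ) ≤ 2 * (n + 1) * (3 * h) ^ d := by
    refine (card_latticeSphere_le hh.1).trans ?_
    gcongr
    omega
  have three_pow : (3 : ℝ) ^ (n + 1) = 3 ^ d * 3 ^ (n - d + 1) := by
    rw [← pow_add]
    congr 1
    omega
  have h_pow : (h : ℝ) ^ (n - d + 1) = h ^ d * h ^ (n - d + 1 - d) := by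
    rw [← pow_add]
    congr 1
    omega
  calc ((latticeSphere (d + 1) h).card : ℝ) * (latticeBox (n - d + 1) (X / h)).card
      ≤ (2 * (n + 1) * (3 * h) ^ d) * (3 * (X / h)) ^ (n - d + 1) :=
        mul_le_mul card_sphere_le card_box_le (Nat.cast_nonneg _) (by positivity)
    _ = _ := by
        rw [three_pow, mul_pow, mul_pow, div_pow, h_pow]
        field_simp

theorem pow_div_pow_le {d h X : ℕ} (hd : d ∈ Finset.Icc 1 (n / 2)) (hh : h ∈ Finset.Icc 1 X) :
    (X : ℝ) ^ (n - d + 1) / (h : ℝ) ^ (n - d + 1 - d) ≤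
      (X : ℝ) ^ n * (1 / (h : ℝ) ^ (n - 1)) + X ^ (n - 1) := by
  rw [Finset.mem_Icc] at hd hh
  have one_le_h : (1 : ℝ) ≤ h := by exact_mod_cast hh.1
  have one_le_X : (1 : ℝ) ≤ X := by exact_mod_cast hh.1.trans hh.2
  rcases hd.1.eq_or_lt with rfl | hd2
  · rw [Nat.sub_add_cancel (by omega), mul_one_div]
    exact le_add_of_nonneg_right (by positivity)
  · refine le_add_of_nonneg_of_le (by positivity) ?_
    exact (div_le_self (by positivity) (one_le_pow₀ one_le_h)).trans
      (pow_le_pow_right₀ one_le_X (by omega))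

theorem card_reducibleBox_le (hn : 1 ≤ n) (B : ℕ) :
    ((reducibleBox n B).card : ℝ) ≤
      n * (2 * (n + 1) * 3 ^ (n + 1)) * ((2 ^ n * (n + 1) * B : ℕ) : ℝ) ^ n *
        (∑ h ∈ Finset.Icc 1 (2 ^ n * (n + 1) * B), 1 / (h : ℝ) ^ (n - 1) + 1) := by
  set X := 2 ^ n * (n + 1) * B
  have inner_le : ∀ d ∈ Finset.Icc 1 (n / 2), ∑ h ∈ Finset.Icc 1 X,
      ((latticeSphere (d + 1) h).card : ℝ) * (latticeBox (n - d + 1) (X / h)).card ≤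
        2 * (n + 1) * 3 ^ (n + 1) *
          ((X : ℝ) ^ n * (∑ h ∈ Finset.Icc 1 X, 1 / (h : ℝ) ^ (n - 1) + 1)) := by
    intro d hd
    refine (Finset.sum_le_sum fun h hh => (card_latticeSphere_mul_card_latticeBox_le hd hh).trans
      (mul_le_mul_of_nonneg_left (pow_div_pow_le hd hh) (by positivity))).trans_eq ?_
    rw [← Finset.mul_sum, Finset.sum_add_distrib, ← Finset.mul_sum, Finset.sum_const, Nat.card_Icc,
      Nat.add_sub_cancel, nsmul_eq_mul, ← pow_succ', Nat.sub_add_cancel hn, ← mul_add_one]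
  calc ((reducibleBox n B).card : ℝ)
      ≤ ∑ d ∈ Finset.Icc 1 (n / 2), ∑ h ∈ Finset.Icc 1 X,
          ((latticeSphere (d + 1) h).card : ℝ) * (latticeBox (n - d + 1) (X / h)).card := by
        exact_mod_cast card_reducibleBox_le_sum n B
    _ ≤ (n / 2 : ℕ) * (2 * (n + 1) * 3 ^ (n + 1) *
          ((X : ℝ) ^ n * (∑ h ∈ Finset.Icc 1 X, 1 / (h : ℝ) ^ (n - 1) + 1))) := by
        refine (Finset.sum_le_card_nsmul _ _ _ inner_le).trans_eq ?_
        rw [Nat.card_Icc, Nat.add_sub_cancel, nsmul_eq_mul]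
    _ ≤ n * (2 * (n + 1) * 3 ^ (n + 1) *
          ((X : ℝ) ^ n * (∑ h ∈ Finset.Icc 1 X, 1 / (h : ℝ) ^ (n - 1) + 1))) := by
        gcongr
        exact Nat.div_le_self n 2
    _ = _ := by ring

theorem sum_one_div_Icc_le_one_add_log (X : ℕ) :
    ∑ h ∈ Finset.Icc 1 X, 1 / (h : ℝ) ≤ 1 + Real.log X := by
  have harmonic_le := harmonic_le_one_add_log X
  rw [harmonic_eq_sum_Icc] at harmonic_le
  push_cast at harmonic_le
  simpa only [one_div] using harmonic_le

theorem exists_add_log_le_mul_log (b : ℝ) :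
    ∃ C : ℝ, ∀ Q : ℝ, 2 ≤ Q → b + Real.log Q ≤ C * Real.log Q := by
  have log_two_pos : 0 < Real.log 2 := Real.log_pos one_lt_two
  refine ⟨|b| / Real.log 2 + 1, fun Q hQ => ?_⟩
  have log_two_le : Real.log 2 ≤ Real.log Q := Real.log_le_log two_pos hQ
  rw [add_mul, one_mul, div_mul_eq_mul_div]
  gcongr
  rw [le_div_iff₀ log_two_pos]
  exact mul_le_mul (le_abs_self b) log_two_le log_two_pos.le (abs_nonneg b)

theorem exists_sum_one_div_pow_add_one_le (hn : 2 ≤ n) {c : ℝ} (hc : 0 < c) :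
    ∃ C : ℝ, ∀ Q : ℝ, 2 ≤ Q → ∀ X : ℕ, 1 ≤ X → (X : ℝ) ≤ c * Q →
      ∑ h ∈ Finset.Icc 1 X, 1 / (h : ℝ) ^ (n - 1) + 1 ≤ C * Real.log Q ^ ell n := by
  rcases hn.eq_or_lt with rfl | hn3
  · obtain ⟨C, hC⟩ := exists_add_log_le_mul_log (2 + Real.log c)
    refine ⟨C, fun Q hQ X hX1 hX => ?_⟩
    have log_le : Real.log X ≤ Real.log c + Real.log Q := by
      rw [← Real.log_mul hc.ne' (by linarith)]
      exact Real.log_le_log (by exact_mod_cast hX1) hX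
    simp only [ell, Nat.add_one_sub_one, pow_one, if_true]
    linarith [sum_one_div_Icc_le_one_add_log X, hC Q hQ]
  · have summable : Summable fun h : ℕ => 1 / (h : ℝ) ^ (n - 1) :=
      Real.summable_one_div_nat_pow.2 (by omega)
    refine ⟨∑' h : ℕ, 1 / (h : ℝ) ^ (n - 1) + 1, fun Q _ X _ _ => ?_⟩
    rw [ell, if_neg hn3.ne', pow_zero, mul_one]
    gcongr
    exact summable.sum_le_tsum _ fun h _ => by positivity

theorem exists_card_reducibleBox_le (hn : 2 ≤ n) :
    ∃ C : ℝ, ∀ Q : ℝ, 2 ≤ Q →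
      ((reducibleBox n ⌊Q⌋₊).card : ℝ) ≤ C * (Q ^ n * Real.log Q ^ ell n) := by
  set c : ℝ := 2 ^ n * (n + 1)
  set K : ℝ := n * (2 * (n + 1) * 3 ^ (n + 1))
  obtain ⟨C, hC⟩ := exists_sum_one_div_pow_add_one_le hn (c := c) (by positivity)
  refine ⟨K * c ^ n * C, fun Q hQ => ?_⟩
  have card_le := card_reducibleBox_le (one_le_two.trans hn) ⌊Q⌋₊
  set X : ℕ := 2 ^ n * (n + 1) * ⌊Q⌋₊ with X_def
  have one_le_floor : 1 ≤ ⌊Q⌋₊ := Nat.le_floor (by push_cast; linarith)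
  have X_le : (X : ℝ) ≤ c * Q := by
    rw [X_def]
    push_cast
    exact mul_le_mul_of_nonneg_left (Nat.floor_le (by linarith)) (by positivity)
  have sum_le := hC Q hQ X (Nat.one_le_iff_ne_zero.2 (by positivity)) X_le
  calc ((reducibleBox n ⌊Q⌋₊).card : ℝ)
      ≤ K * X ^ n * (∑ h ∈ Finset.Icc 1 X, 1 / (h : ℝ) ^ (n - 1) + 1) := card_le
    _ ≤ K * (c * Q) ^ n * (C * Real.log Q ^ ell n) := by gcongr
    _ = _ := by rw [mul_pow]; ring

end Reducible

/-! ### The asymptotic formula and the limit distribution -/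

section Asymptotics

variable {n : ℕ} {I : Set ℝ}

theorem two_mul_remainder_density (n : ℕ) (Q : ℝ) (I : Set ℝ) :
    2 * remainder n (density n) Q I =
      (primitiveCount n ⌊Q⌋₊ I -
          Q ^ (n + 1) / (riemannZeta ((n : ℂ) + 1)).re * ∫ t in I, density n t) -
        (primitiveCount n ⌊Q⌋₊ I - 2 * count n Q I) := by
  rw [remainder, div_mul_eq_div_div_swap]
  ring

theorem pow_le_div_mul_pow_mul_log_pow (n l : ℕ) {Q : ℝ} (hQ : 2 ≤ Q) :
    Q ^ n ≤ 1 / Real.log 2 ^ l * (Q ^ n * Real.log Q ^ l) := by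
  have log_two_pos : 0 < Real.log 2 := Real.log_pos one_lt_two
  have log_two_le : Real.log 2 ≤ Real.log Q := Real.log_le_log two_pos hQ
  rw [div_mul_eq_mul_div, one_mul, le_div_iff₀ (pow_pos log_two_pos l)]
  gcongr

theorem exists_abs_remainder_le (hn : 2 ≤ n) :
    ∃ C : ℝ, ∀ Q : ℝ, 2 ≤ Q → ∀ I : Set ℝ, I.OrdConnected →
      |remainder n (density n) Q I| ≤ C * (Q ^ n * Real.log Q ^ ell n) := by
  obtain ⟨C₁, primitiveCount_sub_main_le⟩ := exists_abs_primitiveCount_sub_le hn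
  obtain ⟨C₂, card_reducible_le⟩ := exists_card_reducibleBox_le hn
  refine ⟨((|C₁| + n * 3 ^ n) * (1 / Real.log 2 ^ ell n) + n * C₂) / 2, fun Q hQ I hI => ?_⟩
  have hQ0 : 0 < Q := by linarith
  set L := Q ^ n * Real.log Q ^ ell n
  have box_le : (2 * (⌊Q⌋₊ : ℝ) + 1) ^ n ≤ (3 * Q) ^ n := by
    gcongr
    linarith [Nat.floor_le hQ0.le]
  have two_mul_le : 2 * |remainder n (density n) Q I| ≤
      ((|C₁| + n * 3 ^ n) * (1 / Real.log 2 ^ ell n) + n * C₂) * L := by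
    calc 2 * |remainder n (density n) Q I|
        = |2 * remainder n (density n) Q I| := by rw [abs_mul, abs_two]
      _ ≤ C₁ * Q ^ n + n * ((2 * ⌊Q⌋₊ + 1) ^ n + (reducibleBox n ⌊Q⌋₊).card) := by
          rw [two_mul_remainder_density]
          exact (abs_sub _ _).trans (add_le_add (primitiveCount_sub_main_le I hI Q hQ0)
            (abs_primitiveCount_sub_two_mul_count_le hn hQ0.le I))
      _ ≤ |C₁| * Q ^ n + n * ((3 * Q) ^ n + C₂ * L) := by
          gcongr
          · exact le_abs_self C₁
          · exact card_reducible_le Q hQ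
      _ = (|C₁| + n * 3 ^ n) * Q ^ n + n * C₂ * L := by rw [mul_pow]; ring
      _ ≤ (|C₁| + n * 3 ^ n) * (1 / Real.log 2 ^ ell n * L) + n * C₂ * L := by
          gcongr
          exact pow_le_div_mul_pow_mul_log_pow n (ell n) hQ
      _ = _ := by ring
  linarith

theorem tendsto_remainder_div_pow (hn : 2 ≤ n) (hI : I.OrdConnected) :
    Tendsto (fun Q : ℝ => remainder n (density n) Q I / Q ^ (n + 1)) atTop (𝓝 0) := by
  obtain ⟨C, hC⟩ := exists_abs_remainder_le hn
  have log_pow_div_tendsto : Tendsto (fun Q : ℝ => C * (Real.log Q ^ ell n / (1 * Q + 0))) atTop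
      (𝓝 0) := by
    simpa using (Real.tendsto_pow_log_div_mul_add_atTop 1 0 (ell n) one_ne_zero).const_mul C
  refine squeeze_zero_norm' ?_ log_pow_div_tendsto
  filter_upwards [eventually_ge_atTop (2 : ℝ)] with Q hQ
  have hQ0 : 0 < Q := by linarith
  rw [Real.norm_eq_abs, abs_div, abs_of_pos (pow_pos hQ0 _), div_le_iff₀ (pow_pos hQ0 _)]
  refine (hC Q hQ I hI).trans_eq ?_
  rw [pow_succ]
  field_simp
  ring

theorem tendsto_count_div_pow (hn : 2 ≤ n) (hI : I.OrdConnected) :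
    Tendsto (fun Q : ℝ => (count n Q I : ℝ) / Q ^ (n + 1)) atTop
      (𝓝 ((∫ x in I, density n x) / (2 * (riemannZeta ((n : ℂ) + 1)).re))) := by
  have remainder_add_tendsto := (tendsto_remainder_div_pow hn hI).add_const
    ((∫ x in I, density n x) / (2 * (riemannZeta ((n : ℂ) + 1)).re))
  rw [zero_add] at remainder_add_tendsto
  refine remainder_add_tendsto.congr' ?_
  filter_upwards [eventually_gt_atTop (0 : ℝ)] with Q hQ
  rw [remainder]
  field_simp
  ring

theorem integral_density_pos (hn : 1 ≤ n) : 0 < ∫ x, density n x :=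
  integral_pos_of_integrable_nonneg_nonzero (x := 0) (continuous_density n) (integrable_density hn)
    (fun x => density_nonneg x) (density_pos hn 0).ne'

theorem tendsto_count_Iic_div_count_univ (hn : 2 ≤ n) (x : ℝ) :
    Tendsto (fun Q : ℝ => (count n Q (Set.Iic x) : ℝ) / (count n Q Set.univ : ℝ)) atTop
      (𝓝 ((∫ y in Set.Iic x, density n y) / ∫ y, density n y)) := by
  have one_le : 1 ≤ n := one_le_two.trans hn
  have two_mul_zeta_ne_zero := mul_ne_zero two_ne_zero (zeta_re_ne_zero one_le)
  have tendsto_Iic := tendsto_count_div_pow hn (Set.ordConnected_Iic (a := x))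
  have tendsto_univ := tendsto_count_div_pow hn Set.ordConnected_univ
  rw [setIntegral_univ] at tendsto_univ
  have tendsto_div := tendsto_Iic.div tendsto_univ
    (div_ne_zero (integral_density_pos one_le).ne' two_mul_zeta_ne_zero)
  rw [div_div_div_cancel_right₀ two_mul_zeta_ne_zero] at tendsto_div
  refine tendsto_div.congr' ?_
  filter_upwards [eventually_gt_atTop (0 : ℝ)] with Q hQ
  exact div_div_div_cancel_right₀ (pow_pos hQ _).ne' _ _

variable {f : ℝ → ℝ}

theorem hasDerivAt_integral_Iic (hint : Integrable f) (hcont : Continuous f) (x : ℝ) :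
    HasDerivAt (fun x => ∫ y in Set.Iic x, f y) (f x) x := by
  have integral_Iic_eq : (fun x => ∫ y in Set.Iic x, f y) =
      fun x => (∫ y in Set.Iic 0, f y) + ∫ y in (0 : ℝ)..x, f y := by
    ext x
    rw [← intervalIntegral.integral_Iic_sub_Iic hint.integrableOn hint.integrableOn]
    ring
  rw [integral_Iic_eq]
  exact (hcont.integral_hasStrictDerivAt 0 x).hasDerivAt.const_add _

theorem contDiff_one_integral_Iic (hint : Integrable f) (hcont : Continuous f) :
    ContDiff ℝ 1 fun x => ∫ y in Set.Iic x, f y := by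
  have hasDerivAt := hasDerivAt_integral_Iic hint hcont
  rw [contDiff_one_iff_deriv, funext fun x => (hasDerivAt x).deriv]
  exact ⟨fun x => (hasDerivAt x).differentiableAt, hcont⟩

end Asymptotics

/-! ### Gaps around rational numbers -/

section Gaps

variable {n : ℕ} {p : ℤ[X]}

theorem abs_tailEval_sub_le {q : Fin n → ℝ} {Q T x y : ℝ} (hq : ∀ k, |q k| ≤ Q)
    (hx : |x| ≤ T) (hy : |y| ≤ T) :
    |tailEval q x - tailEval q y| ≤ Q * (∑ k : Fin n, ((k : ℝ) + 1) * T ^ (k : ℕ)) * |x - y| :=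
  (convex_Icc (-T) T).norm_image_sub_le_of_norm_hasDerivWithin_le
    (fun t _ => (hasDerivAt_tailEval q t).hasDerivWithinAt)
    (fun _ ht => abs_tailDeriv_le hq (abs_le.2 ht)) (abs_le.1 hy) (abs_le.1 hx)

theorem aeval_eq_coeff_zero_add_tailEval (hdeg : p.natDegree ≤ n) (t : ℝ) :
    aeval t p = p.coeff 0 + tailEval (fun k : Fin n => (p.coeff (k + 1) : ℝ)) t := by
  rw [aeval_eq_sum_range' (Nat.lt_succ_of_le hdeg), Finset.sum_range, Fin.sum_univ_succ]
  simp [tailEval]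

theorem abs_aeval_sub_aeval_le {Q T x y : ℝ} (hdeg : p.natDegree ≤ n) (hheight : height p ≤ Q)
    (hx : |x| ≤ T) (hy : |y| ≤ T) :
    |aeval x p - aeval y p| ≤ Q * (∑ k : Fin n, ((k : ℝ) + 1) * T ^ (k : ℕ)) * |x - y| := by
  rw [aeval_eq_coeff_zero_add_tailEval hdeg, aeval_eq_coeff_zero_add_tailEval hdeg,
    add_sub_add_left_eq_sub]
  refine abs_tailEval_sub_le (fun k => le_trans ?_ hheight) hx hy
  rw [← Int.cast_abs, ← Nat.cast_natAbs]
  exact_mod_cast natAbs_coeff_le_height p (k + 1)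

theorem aeval_ratCast_ne_zero (hp : Irreducible p) (hdeg : 2 ≤ p.natDegree) (x : ℚ) :
    aeval (x : ℝ) p ≠ 0 := fun hx => by
  have den_ne_zero : (x.den : ℤ) ≠ 0 := by exact_mod_cast x.den_nz
  have natDegree_eq_one : (C (x.den : ℤ) * X + C (-x.num)).natDegree = 1 :=
    natDegree_linear den_ne_zero
  have aeval_linear : aeval (x : ℝ) (C (x.den : ℤ) * X + C (-x.num)) = 0 := by
    have den_mul : (x.den : ℝ) * x = x.num := by exact_mod_cast Rat.den_mul_eq_num x
    simp [den_mul]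
  have natDegree_le := natDegree_le_of_dvd
    (dvd_of_irreducible_of_common_root hp (by omega) hx aeval_linear)
    (ne_zero_of_natDegree_gt (n := 0) (by omega))
  omega

theorem one_le_den_pow_mul_abs_aeval {x : ℚ} (hx : aeval (x : ℝ) p ≠ 0) :
    1 ≤ (x.den : ℝ) ^ p.natDegree * |aeval (x : ℝ) p| := by
  have num_div_den : ((x.num : ℤ) : ℝ) / ((x.den : ℤ) : ℝ) = x := by
    exact_mod_cast Rat.num_div_den x
  have one_le := one_le_pow_mul_abs_eval_div (K := ℝ) (f := p) (a := x.num) (b := x.den)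
    (by exact_mod_cast x.den_pos)
  rw [num_div_den, eval_map_algebraMap] at one_le
  exact_mod_cast one_le hx

theorem exists_div_lt_abs_sub_of_mem_algebraicNumbers (hn : 2 ≤ n) (x : ℚ) :
    ∃ c : ℝ, 0 < c ∧ c ≤ 1 ∧ ∀ Q : ℝ, ∀ α ∈ algebraicNumbers n Q, c / (|Q| + 1) < |x - α| := by
  set T : ℝ := |(x : ℝ)| + 1
  set D : ℝ := ∑ k : Fin n, ((k : ℝ) + 1) * T ^ (k : ℕ)
  have hD : 0 ≤ D := by positivity
  have one_le_den_pow : (1 : ℝ) ≤ (x.den : ℝ) ^ n := one_le_pow₀ (by exact_mod_cast x.den_pos)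
  set c : ℝ := 1 / ((x.den : ℝ) ^ n * (D + 1)) with c_def
  have c_pos : 0 < c := by positivity
  have c_le_one : c ≤ 1 :=
    div_le_one_of_le₀ (one_le_mul_of_one_le_of_one_le one_le_den_pow (by linarith)) (by positivity)
  refine ⟨c, c_pos, c_le_one, ?_⟩
  rintro Q α ⟨p, hp, natDegree_eq, height_le⟩
  by_contra! hclose
  have hQ : 0 ≤ Q := (Nat.cast_nonneg _).trans height_le
  rw [abs_of_nonneg hQ] at hclose
  have abs_le_T : |α| ≤ T := by
    have close_le_one : |x - α| ≤ 1 :=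
      hclose.trans ((div_le_self c_pos.le (by linarith)).trans c_le_one)
    have := abs_sub_abs_le_abs_sub α (x : ℝ)
    rw [abs_sub_comm] at this
    simp only [T]
    linarith
  have liouville := one_le_den_pow_mul_abs_aeval
    (aeval_ratCast_ne_zero hp.irreducible (hn.trans_eq natDegree_eq.symm) x)
  have lipschitz := abs_aeval_sub_aeval_le natDegree_eq.le height_le
    (le_add_of_nonneg_right zero_le_one : |(x : ℝ)| ≤ T) abs_le_T
  rw [hp.2.1, sub_zero] at lipschitz
  have one_lt_one : (1 : ℝ) < 1 := by
    calc (1 : ℝ) ≤ (x.den : ℝ) ^ n * |aeval (x : ℝ) p| := natDegree_eq ▸ liouville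
      _ ≤ (x.den : ℝ) ^ n * (Q * D * (c / (Q + 1))) := by grw [lipschitz, hclose]
      _ = Q * D / ((Q + 1) * (D + 1)) := by rw [c_def]; field_simp
      _ < 1 := by
          rw [div_lt_one (by positivity)]
          nlinarith
  exact lt_irrefl _ one_lt_one

theorem exists_count_Icc_eq_zero (hn : 2 ≤ n) (x : ℚ) :
    ∃ c : ℝ, 0 < c ∧ c ≤ 1 ∧ ∀ Q : ℝ,
      count n Q (Set.Icc (x - c / (|Q| + 1)) (x + c / (|Q| + 1))) = 0 := by
  obtain ⟨c, c_pos, c_le_one, hgap⟩ := exists_div_lt_abs_sub_of_mem_algebraicNumbers hn x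
  refine ⟨c, c_pos, c_le_one, fun Q => ?_⟩
  rw [count, Set.ncard_eq_zero ((finite_algebraicNumbers n Q).inter_of_left _),
    Set.eq_empty_iff_forall_notMem]
  rintro α ⟨hα, hmem⟩
  rw [← Set.mem_Icc_iff_abs_le] at hmem
  exact (hgap Q α hα).not_ge hmem

theorem exists_setIntegral_Icc_bounds {f : ℝ → ℝ} (hcont : Continuous f) (hpos : ∀ x, 0 < f x)
    (x : ℝ) : ∃ m M : ℝ, 0 < m ∧ 0 < M ∧ ∀ r : ℝ, 0 ≤ r → r ≤ 1 →
      m * (2 * r) ≤ ∫ t in Set.Icc (x - r) (x + r), f t ∧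
        ∫ t in Set.Icc (x - r) (x + r), f t ≤ M * (2 * r) := by
  have nonempty : (Set.Icc (x - 1) (x + 1)).Nonempty := Set.nonempty_Icc.2 (by linarith)
  obtain ⟨a, -, ha⟩ := isCompact_Icc.exists_isMinOn nonempty hcont.continuousOn
  obtain ⟨b, -, hb⟩ := isCompact_Icc.exists_isMaxOn nonempty hcont.continuousOn
  refine ⟨f a, f b, hpos a, hpos b, fun r hr0 hr1 => ?_⟩
  have subset : Set.Icc (x - r) (x + r) ⊆ Set.Icc (x - 1) (x + 1) :=
    Set.Icc_subset_Icc (by linarith) (by linarith)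
  have integrableOn : IntegrableOn f (Set.Icc (x - r) (x + r)) :=
    hcont.continuousOn.integrableOn_compact isCompact_Icc
  have integrableOn_const' : ∀ d : ℝ, IntegrableOn (fun _ => d) (Set.Icc (x - r) (x + r)) :=
    fun d => integrableOn_const isCompact_Icc.measure_lt_top.ne
  have integral_const_eq : ∀ d : ℝ, ∫ _ in Set.Icc (x - r) (x + r), d = d * (2 * r) := fun d => by
    rw [setIntegral_const, Real.volume_real_Icc_of_le (by linarith), smul_eq_mul]
    ring
  rw [← integral_const_eq, ← integral_const_eq]
  exact ⟨setIntegral_mono_on (integrableOn_const' _) integrableOn measurableSet_Icc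
      fun t ht => ha (subset ht),
    setIntegral_mono_on integrableOn (integrableOn_const' _) measurableSet_Icc
      fun t ht => hb (subset ht)⟩

theorem abs_remainder_of_count_eq_zero {Q : ℝ} {I : Set ℝ} (hQ : 0 ≤ Q) (hcount : count n Q I = 0) :
    |remainder n (density n) Q I| =
      Q ^ (n + 1) / (2 * |(riemannZeta ((n : ℂ) + 1)).re|) * ∫ t in I, density n t := by
  rw [remainder, hcount, Nat.cast_zero, zero_sub, abs_neg, abs_mul,
    abs_of_nonneg (setIntegral_density_nonneg n I), abs_div, abs_mul, abs_two,
    abs_of_nonneg (pow_nonneg hQ _)]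

theorem exists_remainder_order (hn : 2 ≤ n) (x : ℚ) :
    ∃ r : ℝ → ℝ, (∀ Q, 0 < r Q) ∧ ∃ c₁ c₂ : ℝ, 0 < c₁ ∧ 0 < c₂ ∧
      ∀ᶠ Q : ℝ in atTop,
        c₁ * Q ^ n ≤ |remainder n (density n) Q (Set.Icc (x - r Q) (x + r Q))| ∧
        |remainder n (density n) Q (Set.Icc (x - r Q) (x + r Q))| ≤ c₂ * Q ^ n := by
  have one_le : 1 ≤ n := one_le_two.trans hn
  obtain ⟨c, c_pos, c_le_one, count_eq_zero⟩ := exists_count_Icc_eq_zero hn x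
  obtain ⟨m, M, m_pos, M_pos, integral_bounds⟩ :=
    exists_setIntegral_Icc_bounds (continuous_density n) (density_pos one_le) x
  have z_pos := abs_pos.2 (zeta_re_ne_zero one_le)
  set z := |(riemannZeta ((n : ℂ) + 1)).re|
  refine ⟨fun Q => c / (|Q| + 1), fun Q => by positivity, m * c / (2 * z), M * c / z,
    by positivity, by positivity, ?_⟩
  filter_upwards [eventually_ge_atTop (1 : ℝ)] with Q hQ
  have Q_pos : 0 < Q := one_pos.trans_le hQ
  rw [abs_remainder_of_count_eq_zero Q_pos.le (count_eq_zero Q), abs_of_pos Q_pos]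
  obtain ⟨integral_ge, integral_le⟩ := integral_bounds (c / (Q + 1)) (by positivity)
    ((div_le_self c_pos.le (by linarith)).trans c_le_one)
  have half_le : 1 / 2 ≤ Q / (Q + 1) := by
    rw [div_le_div_iff₀ two_pos (by linarith)]
    linarith
  have le_one : Q / (Q + 1) ≤ 1 := div_le_one_of_le₀ (by linarith) (by linarith)
  constructor
  · calc m * c / (2 * z) * Q ^ n = m * c / z * Q ^ n * (1 / 2) := by ring
      _ ≤ m * c / z * Q ^ n * (Q / (Q + 1)) := by gcongr
      _ = Q ^ (n + 1) / (2 * z) * (m * (2 * (c / (Q + 1)))) := by rw [pow_succ]; field_simp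
      _ ≤ _ := by gcongr
  · calc Q ^ (n + 1) / (2 * z) * ∫ t in Set.Icc (x - c / (Q + 1)) (x + c / (Q + 1)), density n t
        ≤ Q ^ (n + 1) / (2 * z) * (M * (2 * (c / (Q + 1)))) := by gcongr
      _ = M * c / z * Q ^ n * (Q / (Q + 1)) := by rw [pow_succ]; field_simp
      _ ≤ M * c / z * Q ^ n * 1 := by gcongr
      _ = _ := mul_one _

end Gaps

end RealAlgebraic

end

theorem theorem1 (n : ℕ) (hn : 2 ≤ n) :
    ∃ φ : ℝ → ℝ,
      Continuous φ ∧ (∀ x, 0 < φ x) ∧ Integrable φ ∧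
      -- the asymptotic formula, uniformly in all intervals (bounded or not)
      (∃ C : ℝ, ∀ Q : ℝ, 2 ≤ Q → ∀ I : Set ℝ, I.OrdConnected →
        |RealAlgebraic.remainder n φ Q I| ≤ C * (Q ^ n * Real.log Q ^ RealAlgebraic.ell n)) ∧
      -- infinitely many intervals (one for every rational midpoint) with remainder of order `Q ^ n`
      (∀ x₀ : ℚ, ∃ r : ℝ → ℝ, (∀ Q, 0 < r Q) ∧ ∃ c₁ c₂ : ℝ, 0 < c₁ ∧ 0 < c₂ ∧
        ∀ᶠ Q : ℝ in atTop,
          c₁ * Q ^ n ≤ |RealAlgebraic.remainder n φ Q (Set.Icc (x₀ - r Q) (x₀ + r Q))| ∧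
          |RealAlgebraic.remainder n φ Q (Set.Icc (x₀ - r Q) (x₀ + r Q))| ≤ c₂ * Q ^ n) ∧
      (∀ x, φ (-x) = φ x) ∧
      (∀ x, x ≠ 0 → x ^ 2 * φ x = φ (1 / x)) ∧
      (∀ t, φ t = ∫ p in RealAlgebraic.region n t,
        |∑ k : Fin n, ((k : ℝ) + 1) * p k * t ^ (k : ℕ)|) ∧
      -- the distribution function exists and is continuously differentiable
      (∃ F : ℝ → ℝ,
        (∀ x, Tendsto (fun Q : ℝ => (RealAlgebraic.count n Q (Set.Iic x) : ℝ) /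
          (RealAlgebraic.count n Q Set.univ : ℝ)) atTop (𝓝 (F x))) ∧
        ContDiff ℝ 1 F ∧
        ∀ x, HasDerivAt F (φ x / ∫ y, φ y) x) := by
  have one_le : 1 ≤ n := one_le_two.trans hn
  have integrable := RealAlgebraic.integrable_density one_le
  have continuous := RealAlgebraic.continuous_density n
  exact ⟨RealAlgebraic.density n, continuous, RealAlgebraic.density_pos one_le, integrable,
    RealAlgebraic.exists_abs_remainder_le hn, RealAlgebraic.exists_remainder_order hn,
    RealAlgebraic.density_neg, fun _ => RealAlgebraic.sq_mul_density one_le,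
    RealAlgebraic.density_eq_integral_region n, _,
    RealAlgebraic.tendsto_count_Iic_div_count_univ hn,
    (RealAlgebraic.contDiff_one_integral_Iic integrable continuous).div_const _,
    fun x => (RealAlgebraic.hasDerivAt_integral_Iic integrable continuous x).div_const _⟩
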